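/- Let $\mathbb{K}$ be $\mathbb{R}$ or $\mathbb{C}$. For a Banach space $X$ over $\mathbb{K}$ with dual $X^*$, let $\mathcal{L}(X)$ be the space of bounded linear operators on $X$. For $T\in\mathcal{L}(X)$ put $$v(T)=\sup\{|x^*(Tx)| : x\in X,\ x^*\in X^*,\ \|x\|=\|x^*\|=x^*(x)=1\},$$ and let $n(X)=\inf\{v(T) : T\in\mathcal{L}(X),\ \|T\|=1\}$ be the numerical index of $X$ (for $X=\{0\}$ there is no operator of norm one, and we set $n(\{0\})=0$). For Banach spaces $X,Y$ let $\mathcal{K}(X,Y)$ be the space of compact linear operators from $X$ to $Y$ with the operator norm, and $\mathcal{K}(X)=\mathcal{K}(X,X)$. Let $X$ be a Banach space over $\mathbb{K}$ such that $n(X^{***})=1$, and let $Z$ be an isometric predual of $\ell_1$, that is, a Banach space over $\mathbb{K}$ whose dual $Z^*$ is isometrically isomorphic to $\ell_1$. Then $$n\big(\mathcal{K}(X,Z)^{**}\big)=n\big(\mathcal{K}(X,Z)^{*}\big)=n\big(\mathcal{K}(X,Z)\big)=1.$$ In particular, $$n\big(\mathcal{K}(c_0)\big)=n\big(\mathcal{K}(c_0)^*\big)=n\big(\mathcal{K}(c_0)^{**}\big)=n\big(\mathcal{L}(\ell_\infty)\big)=1\quad\text{and}\quad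 n\big(\mathcal{K}(\ell_1,c_0)^{**}\big)=1,$$ where $c_0,\ell_1,\ell_\infty$ are the usual sequence spaces over $\mathbb{K}$. -/

import Mathlib

set_option maxSynthPendingDepth 3

open scoped ENNReal ZeroAtInfty

noncomputable section

/-- The numerical range `V(T) = {x*(T x) : ‖x‖ = 1, ‖x*‖ = 1, x*(x) = 1}` of a bounded operator. -/
def numericalRange {𝕜 : Type*} [RCLike 𝕜] {X : Type*} [NormedAddCommGroup X] [NormedSpace 𝕜 X]
    (T : X →L[𝕜] X) : Set 𝕜 :=
  {c : 𝕜 | ∃ (x : X) (f : StrongDual 𝕜 X), ‖x‖ = 1 ∧ ‖f‖ = 1 ∧ f x = 1 ∧ c = f (T x)}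

/-- The numerical radius `v(T) = sup {|c| : c ∈ V(T)}`. -/
def numericalRadius {𝕜 : Type*} [RCLike 𝕜] {X : Type*} [NormedAddCommGroup X] [NormedSpace 𝕜 X]
    (T : X →L[𝕜] X) : ℝ :=
  sSup ((fun c : 𝕜 => ‖c‖) '' numericalRange T)

/-- The numerical index `n(X) = inf {v(T) : T ∈ L(X), ‖T‖ = 1}`.
The zero space, which has no operator of norm one, gets the value `0`. -/
def numericalIndex (𝕜 : Type*) [RCLike 𝕜] (X : Type*) [NormedAddCommGroup X]
    [NormedSpace 𝕜 X] : ℝ :=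
  sInf {r : ℝ | ∃ T : X →L[𝕜] X, ‖T‖ = 1 ∧ r = numericalRadius T}

/-- The space `K(X, Y)` of compact operators, with the operator norm. -/
abbrev CompactOps (𝕜 : Type*) [RCLike 𝕜] (X Y : Type*) [NormedAddCommGroup X] [NormedSpace 𝕜 X]
    [NormedAddCommGroup Y] [NormedSpace 𝕜 Y] : Type _ :=
  ↥(compactOperator (RingHom.id 𝕜) X Y)

/-- The space of null sequences: functions on the discrete space `ℕ` that vanish at infinity,
with the supremum norm. -/
abbrev SeqC0 (𝕜 : Type*) [RCLike 𝕜] : Type _ := C₀(ℕ, 𝕜)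

/-- The space of absolutely summable sequences. -/
abbrev SeqL1 (𝕜 : Type*) [RCLike 𝕜] : Type _ := ↥(lp (fun _ : ℕ => 𝕜) 1)

/-- The space of bounded sequences. -/
abbrev SeqLInfty (𝕜 : Type*) [RCLike 𝕜] : Type _ := ↥(lp (fun _ : ℕ => 𝕜) ∞)

/-- `Z` is an isometric predual of `ℓ₁`: its dual is isometrically isomorphic to `ℓ₁`. -/
def IsIsometricPredualL1 (𝕜 : Type*) [RCLike 𝕜] (Z : Type*) [NormedAddCommGroup Z]
    [NormedSpace 𝕜 Z] : Prop :=
  Nonempty (StrongDual 𝕜 Z ≃ₗᵢ[𝕜] SeqL1 𝕜)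

end

section AlternativeDaugavet

variable {𝕜 : Type*} [RCLike 𝕜]

/-- The alternative Daugavet equation `max_θ ‖1 + θ T‖ = 1 + ‖T‖` holds for every operator
on `Y`, in approximate form. -/
def AlternativeDaugavet (𝕜 : Type*) [RCLike 𝕜] (Y : Type*) [NormedAddCommGroup Y]
    [NormedSpace 𝕜 Y] : Prop :=
  ∀ T : Y →L[𝕜] Y, ∀ ε > 0, ∃ θ : 𝕜, ‖θ‖ = 1 ∧ 1 + ‖T‖ - ε ≤ ‖ContinuousLinearMap.id 𝕜 Y + θ • T‖

variable {Y : Type*} [NormedAddCommGroup Y] [NormedSpace 𝕜 Y]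

/-- A scalar times a phase is its modulus. -/
theorem exists_norm_one_mul_eq_norm (c : 𝕜) : ∃ θ : 𝕜, ‖θ‖ = 1 ∧ θ * c = (‖c‖ : 𝕜) := by
  by_cases hc : c = 0
  · exact ⟨1, by simp, by simp [hc]⟩
  · refine ⟨(‖c‖ : 𝕜) * c⁻¹, ?_, ?_⟩
    · have : ‖c‖ ≠ 0 := by simpa using hc
      simp [this]
    · field_simp

theorem AlternativeDaugavet.nontrivial (h : AlternativeDaugavet 𝕜 Y) : Nontrivial Y := by
  by_contra hY
  rw [not_nontrivial_iff_subsingleton] at hY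
  obtain ⟨θ, -, h1⟩ := h 0 (1 / 2) (by norm_num)
  have : ContinuousLinearMap.id 𝕜 Y + θ • (0 : Y →L[𝕜] Y) = 0 := Subsingleton.elim _ _
  rw [this] at h1
  norm_num at h1

theorem bddAbove_norm_numericalRange (T : Y →L[𝕜] Y) :
    BddAbove ((fun c : 𝕜 => ‖c‖) '' numericalRange T) := by
  refine ⟨‖T‖, ?_⟩
  rintro _ ⟨c, ⟨x, f, hx, hf, -, rfl⟩, rfl⟩
  calc ‖f (T x)‖ ≤ ‖f‖ * ‖T x‖ := f.le_opNorm _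
    _ ≤ 1 * (‖T‖ * ‖x‖) := by rw [hf]; gcongr; exact T.le_opNorm _
    _ = ‖T‖ := by rw [hx]; ring

theorem norm_le_numericalRadius (T : Y →L[𝕜] Y) {x : Y} {f : StrongDual 𝕜 Y} (hx : ‖x‖ = 1)
    (hf : ‖f‖ = 1) (hfx : f x = 1) : ‖f (T x)‖ ≤ numericalRadius T :=
  le_csSup (bddAbove_norm_numericalRange T) ⟨_, ⟨x, f, hx, hf, hfx, rfl⟩, rfl⟩

theorem numericalRadius_nonneg (T : Y →L[𝕜] Y) : 0 ≤ numericalRadius T :=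
  Real.sSup_nonneg (by rintro _ ⟨c, -, rfl⟩; exact norm_nonneg _)

theorem bddBelow_numericalRadius :
    BddBelow {r : ℝ | ∃ T : Y →L[𝕜] Y, ‖T‖ = 1 ∧ r = numericalRadius T} := by
  refine ⟨0, ?_⟩
  rintro _ ⟨T, -, rfl⟩
  exact numericalRadius_nonneg T

theorem numericalRadius_le_norm (T : Y →L[𝕜] Y) : numericalRadius T ≤ ‖T‖ := by
  refine Real.sSup_le ?_ (norm_nonneg _)
  rintro _ ⟨c, ⟨x, f, hx, hf, -, rfl⟩, rfl⟩
  calc ‖f (T x)‖ ≤ ‖f‖ * ‖T x‖ := f.le_opNorm _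
    _ ≤ 1 * (‖T‖ * ‖x‖) := by rw [hf]; gcongr; exact T.le_opNorm _
    _ = ‖T‖ := by rw [hx]; ring

theorem mul_norm_le_norm_sub (T : Y →L[𝕜] Y) (z : Y) :
    (1 - numericalRadius T) * ‖z‖ ≤ ‖z - T z‖ := by
  by_cases hz : z = 0
  · simp [hz]
  have hz' : ‖z‖ ≠ 0 := by simpa using hz
  obtain ⟨f, hf, hfz⟩ := exists_dual_vector 𝕜 z hz'
  set x : Y := ((‖z‖ : 𝕜)⁻¹) • z with hx
  have hzn : (‖z‖ : 𝕜) ≠ 0 := by exact_mod_cast hz'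
  have hx1 : ‖x‖ = 1 := by simp [hx, norm_smul, hz']
  have hfx : f x = 1 := by simp [hx, hfz, hzn]
  have h1 : ‖f (T x)‖ ≤ numericalRadius T := norm_le_numericalRadius T hx1 hf hfx
  have h2 : z = (‖z‖ : 𝕜) • x := by simp [hx, smul_smul, hzn]
  have h3 : ‖f (T z)‖ ≤ numericalRadius T * ‖z‖ := by
    conv_lhs => rw [h2]
    rw [map_smul, map_smul, norm_smul, mul_comm]
    simpa using mul_le_mul_of_nonneg_right h1 (norm_nonneg z)
  calc (1 - numericalRadius T) * ‖z‖ ≤ ‖f z‖ - ‖f (T z)‖ := by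
        rw [hfz]; simp; linarith
    _ ≤ ‖f z - f (T z)‖ := norm_sub_norm_le _ _
    _ = ‖f (z - T z)‖ := by rw [map_sub]
    _ ≤ ‖z - T z‖ := by simpa [hf] using f.le_opNorm (z - T z)

theorem mul_norm_id_add_le (T : Y →L[𝕜] Y) (hT : numericalRadius T ≤ 1) :
    (1 - numericalRadius T) * ‖ContinuousLinearMap.id 𝕜 Y + T‖ ≤ 1 + ‖T‖ ^ 2 := by
  have key : ∀ x : Y, (1 - numericalRadius T) * ‖x + T x‖ ≤ (1 + ‖T‖ ^ 2) * ‖x‖ := by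
    intro x
    calc (1 - numericalRadius T) * ‖x + T x‖ ≤ ‖(x + T x) - T (x + T x)‖ := mul_norm_le_norm_sub T _
      _ = ‖x - T (T x)‖ := by congr 1; rw [map_add]; abel
      _ ≤ ‖x‖ + ‖T‖ * (‖T‖ * ‖x‖) := by
        refine (norm_sub_le _ _).trans ?_
        gcongr
        exact (T.le_opNorm _).trans (by gcongr; exact T.le_opNorm _)
      _ = (1 + ‖T‖ ^ 2) * ‖x‖ := by ring
  rcases hT.eq_or_lt with h | h
  · rw [h]; simp; positivity
  · rw [mul_comm, ← le_div_iff₀ (by linarith)]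
    refine ContinuousLinearMap.opNorm_le_bound _ (div_nonneg (by positivity) (by linarith)) fun x => ?_
    rw [div_mul_eq_mul_div, le_div_iff₀ (by linarith), mul_comm]
    exact key x

theorem numericalRadius_smul (c : 𝕜) (T : Y →L[𝕜] Y) :
    numericalRadius (c • T) ≤ ‖c‖ * numericalRadius T := by
  refine Real.sSup_le ?_ (mul_nonneg (norm_nonneg _) (numericalRadius_nonneg T))
  rintro _ ⟨_, ⟨x, f, hx, hf, hfx, rfl⟩, rfl⟩
  simp only [smul_apply, map_smul, norm_smul]
  gcongr
  exact norm_le_numericalRadius T hx hf hfx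

theorem AlternativeDaugavet.norm_le_numericalRadius (h : AlternativeDaugavet 𝕜 Y)
    (T : Y →L[𝕜] Y) (hT : ‖T‖ = 1) : 1 ≤ numericalRadius T := by
  set v := numericalRadius T with hv
  have hv0 : 0 ≤ v := numericalRadius_nonneg T
  have hv1 : v ≤ 1 := hT ▸ numericalRadius_le_norm T
  have key : ∀ α : ℝ, 0 < α → α ≤ 1 → (1 - α * v) * (1 + α) ≤ 1 + α ^ 2 := by
    intro α h0 h1
    have hn : ‖(α : 𝕜) • T‖ = α := by simp [norm_smul, hT, abs_of_pos h0]
    refine le_of_forall_pos_le_add fun ε hε => ?_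
    obtain ⟨θ, hθ, hle⟩ := h ((α : 𝕜) • T) ε hε
    set S := θ • (α : 𝕜) • T
    have hS : ‖S‖ = α := by rw [norm_smul, hθ, hn, one_mul]
    have hvS : numericalRadius S ≤ α * v := by
      have := numericalRadius_smul (θ * (α : 𝕜)) T
      rwa [mul_smul, norm_mul, hθ, one_mul, RCLike.norm_ofReal, abs_of_pos h0] at this
    have hα : α * v ≤ 1 := by nlinarith
    have h2 := mul_norm_id_add_le S (hvS.trans hα)
    rw [hS] at h2
    rw [hn] at hle
    have h3 : (1 - α * v) * ‖ContinuousLinearMap.id 𝕜 Y + S‖ ≤ 1 + α ^ 2 :=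
      (mul_le_mul_of_nonneg_right (by linarith) (norm_nonneg _)).trans h2
    have h4 : (1 - α * v) * (1 + α - ε) ≤ (1 - α * v) * ‖ContinuousLinearMap.id 𝕜 Y + S‖ :=
      mul_le_mul_of_nonneg_left hle (by linarith)
    have h5 : 0 ≤ α * v * ε := by positivity
    nlinarith
  by_contra hlt
  push Not at hlt
  have h6 := key ((1 - v) / 4) (by linarith) (by linarith)
  nlinarith [mul_pos (sub_pos.2 hlt) (sub_pos.2 hlt)]

theorem AlternativeDaugavet.numericalIndex_eq_one (h : AlternativeDaugavet 𝕜 Y) :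
    numericalIndex 𝕜 Y = 1 := by
  have := h.nontrivial
  have hid : ‖ContinuousLinearMap.id 𝕜 Y‖ = 1 := ContinuousLinearMap.norm_id
  refine le_antisymm ?_ ?_
  · exact (csInf_le bddBelow_numericalRadius ⟨ContinuousLinearMap.id 𝕜 Y, hid, rfl⟩).trans
      ((numericalRadius_le_norm _).trans hid.le)
  · refine le_csInf ⟨_, ContinuousLinearMap.id 𝕜 Y, hid, rfl⟩ ?_
    rintro _ ⟨T, hT, rfl⟩
    exact h.norm_le_numericalRadius T hT

theorem alternativeDaugavet_of_numericalIndex_eq_one (h : numericalIndex 𝕜 Y = 1) :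
    AlternativeDaugavet 𝕜 Y := by
  have hY : Nontrivial Y := by
    by_contra hY
    rw [not_nontrivial_iff_subsingleton] at hY
    have : {r : ℝ | ∃ T : Y →L[𝕜] Y, ‖T‖ = 1 ∧ r = numericalRadius T} = ∅ := by
      ext r
      simp only [Set.mem_ofPred_eq, Set.mem_empty_iff_false, iff_false]
      rintro ⟨T, hT, -⟩
      rw [Subsingleton.elim T 0, norm_zero] at hT
      exact zero_ne_one hT
    rw [numericalIndex, this, Real.sInf_empty] at h
    exact zero_ne_one h
  intro T ε hε
  by_cases hT : T = 0
  · exact ⟨1, by simp, by simp [hT, hε.le]⟩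
  have hTn : 0 < ‖T‖ := by simpa using hT
  set S : Y →L[𝕜] Y := ((‖T‖ : 𝕜)⁻¹) • T with hS
  have hS1 : ‖S‖ = 1 := by simp [hS, norm_smul, hTn.ne']
  have hTS : T = (‖T‖ : 𝕜) • S := by
    have : (‖T‖ : 𝕜) ≠ 0 := by exact_mod_cast hTn.ne'
    simp [hS, smul_smul, this]
  have hv : 1 ≤ numericalRadius S := by
    rw [← h]
    exact csInf_le bddBelow_numericalRadius ⟨S, hS1, rfl⟩
  have hne : ((fun c : 𝕜 => ‖c‖) '' numericalRange S).Nonempty := by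
    by_contra hne
    rw [Set.not_nonempty_iff_eq_empty] at hne
    rw [numericalRadius, hne, Real.sSup_empty] at hv
    exact absurd hv (by norm_num)
  obtain ⟨_, ⟨_, ⟨x, f, hx, hf, hfx, rfl⟩, rfl⟩, hlt⟩ :=
    exists_lt_of_lt_csSup hne (show 1 - ε / ‖T‖ < numericalRadius S by
      have : 0 < ε / ‖T‖ := by positivity
      linarith)
  obtain ⟨θ, hθ, hθc⟩ := exists_norm_one_mul_eq_norm (f (T x))
  refine ⟨θ, hθ, ?_⟩
  have h1 : ‖T‖ - ε ≤ ‖f (T x)‖ := by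
    conv_rhs => rw [hTS]
    simp only [smul_apply, map_smul, norm_smul, RCLike.norm_ofReal, abs_norm]
    have := mul_le_mul_of_nonneg_left hlt.le hTn.le
    rw [mul_sub, mul_div_cancel₀ _ hTn.ne', mul_one] at this
    exact this
  calc 1 + ‖T‖ - ε ≤ ‖(1 : 𝕜) + (‖f (T x)‖ : 𝕜)‖ := by
        have : (1 : 𝕜) + (‖f (T x)‖ : 𝕜) = ((1 + ‖f (T x)‖ : ℝ) : 𝕜) := by push_cast; rfl
        rw [this, RCLike.norm_ofReal, abs_of_nonneg (by positivity)]
        linarith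
    _ = ‖f ((ContinuousLinearMap.id 𝕜 Y + θ • T) x)‖ := by
        simp [hfx, ← hθc]
    _ ≤ ‖ContinuousLinearMap.id 𝕜 Y + θ • T‖ := by
        have h2 := f.le_opNorm ((ContinuousLinearMap.id 𝕜 Y + θ • T) x)
        have h3 := (ContinuousLinearMap.id 𝕜 Y + θ • T).le_opNorm x
        rw [hf, one_mul] at h2
        rw [hx, mul_one] at h3
        exact h2.trans h3

theorem numericalIndex_eq_one_iff : numericalIndex 𝕜 Y = 1 ↔ AlternativeDaugavet 𝕜 Y :=
  ⟨alternativeDaugavet_of_numericalIndex_eq_one, fun h => h.numericalIndex_eq_one⟩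

/-- The adjoint of a bounded operator. -/
noncomputable def dualOperator {V W : Type*} [NormedAddCommGroup V] [NormedSpace 𝕜 V]
    [NormedAddCommGroup W] [NormedSpace 𝕜 W] (T : V →L[𝕜] W) :
    StrongDual 𝕜 W →L[𝕜] StrongDual 𝕜 V :=
  (ContinuousLinearMap.compL 𝕜 V W 𝕜).flip T

theorem dualOperator_apply {V W : Type*} [NormedAddCommGroup V] [NormedSpace 𝕜 V]
    [NormedAddCommGroup W] [NormedSpace 𝕜 W] (T : V →L[𝕜] W) (f : StrongDual 𝕜 W) (x : V) :
    dualOperator T f x = f (T x) := rfl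

theorem norm_dualOperator {V W : Type*} [NormedAddCommGroup V] [NormedSpace 𝕜 V]
    [NormedAddCommGroup W] [NormedSpace 𝕜 W] (T : V →L[𝕜] W) : ‖dualOperator T‖ = ‖T‖ := by
  refine le_antisymm ?_ ?_
  · refine ContinuousLinearMap.opNorm_le_bound _ (norm_nonneg _) fun f => ?_
    rw [mul_comm]
    exact f.opNorm_comp_le T
  · refine ContinuousLinearMap.opNorm_le_bound _ (norm_nonneg _) fun x => ?_
    obtain ⟨f, hf, hfx⟩ := exists_dual_vector'' 𝕜 (T x)
    calc ‖T x‖ = ‖dualOperator T f x‖ := by rw [dualOperator_apply, hfx]; simp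
      _ ≤ ‖dualOperator T f‖ * ‖x‖ := ContinuousLinearMap.le_opNorm _ _
      _ ≤ (‖dualOperator T‖ * 1) * ‖x‖ := by
        gcongr
        exact (ContinuousLinearMap.le_opNorm _ _).trans (by gcongr)
      _ = _ := by rw [mul_one]

theorem AlternativeDaugavet.of_dual (h : AlternativeDaugavet 𝕜 (StrongDual 𝕜 Y)) :
    AlternativeDaugavet 𝕜 Y := by
  intro T ε hε
  obtain ⟨θ, hθ, hle⟩ := h (dualOperator T) ε hε
  refine ⟨θ, hθ, ?_⟩
  rw [norm_dualOperator] at hle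
  refine hle.trans (le_of_eq ?_)
  rw [← norm_dualOperator (ContinuousLinearMap.id 𝕜 Y + θ • T)]
  congr 1
  ext f x
  simp [dualOperator_apply]

theorem AlternativeDaugavet.congr {V : Type*} [NormedAddCommGroup V] [NormedSpace 𝕜 V]
    (e : Y ≃ₗᵢ[𝕜] V) (h : AlternativeDaugavet 𝕜 Y) : AlternativeDaugavet 𝕜 V := by
  have norm_conj : ∀ S : V →L[𝕜] V, ‖(e.symm.toContinuousLinearEquiv : V →L[𝕜] Y) ∘L S ∘L
      (e.toContinuousLinearEquiv : Y →L[𝕜] V)‖ = ‖S‖ := by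
    intro S
    refine le_antisymm ?_ ?_
    · refine ContinuousLinearMap.opNorm_le_bound _ (norm_nonneg _) fun x => ?_
      simpa using S.le_opNorm (e x)
    · refine ContinuousLinearMap.opNorm_le_bound _ (norm_nonneg _) fun x => ?_
      simpa using ((e.symm.toContinuousLinearEquiv : V →L[𝕜] Y) ∘L S ∘L
        (e.toContinuousLinearEquiv : Y →L[𝕜] V)).le_opNorm (e.symm x)
  intro T ε hε
  obtain ⟨θ, hθ, hle⟩ := h _ ε hε
  refine ⟨θ, hθ, ?_⟩
  rw [← norm_conj T, ← norm_conj (ContinuousLinearMap.id 𝕜 V + θ • T)]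
  refine hle.trans (le_of_eq ?_)
  congr 1
  ext x
  simp

/-- The isometry between duals induced by an isometry. -/
noncomputable def dualIsometry {V W : Type*} [NormedAddCommGroup V] [NormedSpace 𝕜 V]
    [NormedAddCommGroup W] [NormedSpace 𝕜 W] (e : V ≃ₗᵢ[𝕜] W) :
    StrongDual 𝕜 V ≃ₗᵢ[𝕜] StrongDual 𝕜 W where
  toFun := dualOperator (e.symm.toContinuousLinearEquiv : W →L[𝕜] V)
  invFun := dualOperator (e.toContinuousLinearEquiv : V →L[𝕜] W)
  left_inv f := by ext x; simp [dualOperator_apply]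
  right_inv f := by ext x; simp [dualOperator_apply]
  map_add' f g := map_add _ f g
  map_smul' c f := map_smul _ c f
  norm_map' f := by
    refine le_antisymm ?_ ?_
    · refine ContinuousLinearMap.opNorm_le_bound _ (norm_nonneg _) fun x => ?_
      simpa [dualOperator_apply] using f.le_opNorm (e.symm x)
    · refine ContinuousLinearMap.opNorm_le_bound _ (norm_nonneg _) fun x => ?_
      simpa [dualOperator_apply] using
        (dualOperator (e.symm.toContinuousLinearEquiv : W →L[𝕜] V) f).le_opNorm (e x)

end AlternativeDaugavet

section MStructure

variable {𝕜 : Type*} [RCLike 𝕜] {G W : Type*} [NormedAddCommGroup G] [NormedSpace 𝕜 G]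
  [NormedAddCommGroup W] [NormedSpace 𝕜 W]

/-- In a nontrivial space every vector of the unit ball is a convex combination of two unit vectors. -/
theorem exists_convex_combination_unit [Nontrivial W] (w : W) (hw : ‖w‖ ≤ 1) :
    ∃ (u v : W) (s t : ℝ), ‖u‖ = 1 ∧ ‖v‖ = 1 ∧ 0 ≤ s ∧ 0 ≤ t ∧ s + t = 1 ∧
      w = (s : 𝕜) • u + (t : 𝕜) • v := by
  obtain ⟨u, hu, hwu⟩ : ∃ u : W, ‖u‖ = 1 ∧ w = (‖w‖ : 𝕜) • u := by
    by_cases h : w = 0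
    · obtain ⟨x, hx⟩ := exists_ne (0 : W)
      have hx' : ‖x‖ ≠ 0 := by simpa using hx
      exact ⟨((‖x‖ : 𝕜)⁻¹) • x, by simp [norm_smul, hx'], by simp [h]⟩
    · have h' : ‖w‖ ≠ 0 := by simpa using h
      have h'' : (‖w‖ : 𝕜) ≠ 0 := by exact_mod_cast h'
      exact ⟨((‖w‖ : 𝕜)⁻¹) • w, by simp [norm_smul, h'], by simp [smul_smul, h'']⟩
  refine ⟨u, -u, (1 + ‖w‖) / 2, (1 - ‖w‖) / 2, hu, by simp [hu], by positivity, by linarith,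
    by ring, ?_⟩
  rw [smul_neg, ← sub_eq_add_neg, ← sub_smul]
  conv_lhs => rw [hwu]
  congr 1
  push_cast
  ring

/-- A space that is normed by a family of mutually complementary `M`-projections onto copies of a
space with the alternative Daugavet property has that property. -/
theorem AlternativeDaugavet.of_mSummands {ι : Type*} [Nonempty ι] (hW : AlternativeDaugavet 𝕜 W)
    (P : ι → G →L[𝕜] W) (J : ι → W →L[𝕜] G) (hPJ : ∀ i w, P i (J i w) = w)
    (hP : ∀ i g, ‖P i g‖ ≤ ‖g‖)
    (hJ : ∀ i w g, ‖w‖ ≤ 1 → ‖g‖ ≤ 1 → ‖J i w + (g - J i (P i g))‖ ≤ 1)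
    (hnorm : ∀ (g : G) (C : ℝ), 0 ≤ C → (∀ i, ‖P i g‖ ≤ C) → ‖g‖ ≤ C) :
    AlternativeDaugavet 𝕜 G := by
  have := hW.nontrivial
  intro T ε hε
  obtain ⟨g, hg, i, hgi⟩ : ∃ g : G, ‖g‖ ≤ 1 ∧ ∃ i, ‖T‖ - ε / 2 < ‖P i (T g)‖ := by
    by_cases hT : ‖T‖ - ε / 2 < 0
    · exact ⟨0, by simp, Classical.arbitrary ι, hT.trans_le (norm_nonneg _)⟩
    · push Not at hT
      obtain ⟨x, hx, hTx⟩ := T.exists_lt_apply_of_lt_opNorm (show ‖T‖ - ε / 2 < ‖T‖ by linarith)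
      refine ⟨x, hx.le, ?_⟩
      by_contra! hcon
      exact absurd (hnorm _ _ hT hcon) (not_le.2 hTx)
  set h := g - J i (P i g) with hh
  have hPh : P i h = 0 := by simp [hh, hPJ]
  obtain ⟨w₀, hw₀, hBw₀⟩ : ∃ w₀ : W, ‖w₀‖ = 1 ∧ ‖T‖ - ε / 2 < ‖P i (T (J i w₀ + h))‖ := by
    obtain ⟨u, v, s, t, hu, hv, hs, ht, hst, hw⟩ :=
      exists_convex_combination_unit (𝕜 := 𝕜) (P i g) ((hP i g).trans hg)
    by_contra! hcon
    have hst' : (s : 𝕜) + (t : 𝕜) = 1 := by exact_mod_cast hst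
    have hgdec : g = (s : 𝕜) • (J i u + h) + (t : 𝕜) • (J i v + h) := by
      have : g = J i (P i g) + ((s : 𝕜) + (t : 𝕜)) • h := by rw [hst', hh]; simp
      conv_lhs => rw [this, hw]
      simp only [map_add, map_smul]
      module
    have : ‖P i (T g)‖ ≤ s * (‖T‖ - ε / 2) + t * (‖T‖ - ε / 2) := by
      conv_lhs => rw [hgdec]
      simp only [map_add (P i), map_add T, map_smul T, map_smul (P i)]
      rw [← map_add (P i), ← map_add (P i), ← map_add T, ← map_add T]
      refine (norm_add_le _ _).trans ?_
      rw [norm_smul, norm_smul, RCLike.norm_ofReal, RCLike.norm_ofReal, abs_of_nonneg hs,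
        abs_of_nonneg ht]
      gcongr
      · exact hcon u hu
      · exact hcon v hv
    rw [← add_mul, hst, one_mul] at this
    linarith
  obtain ⟨f, hf, hfw⟩ := exists_dual_vector 𝕜 w₀ (by rw [hw₀]; exact one_ne_zero)
  rw [hw₀, RCLike.ofReal_one] at hfw
  let S : W →L[𝕜] W := P i ∘L T ∘L (J i + f.smulRight h)
  have hS : ∀ w, S w = P i (T (J i w + f w • h)) := fun w => rfl
  have hSn : ‖T‖ - ε / 2 < ‖S‖ := by
    have h1 := S.le_opNorm w₀
    rw [hw₀, mul_one, hS, hfw, one_smul] at h1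
    exact hBw₀.trans_le h1
  obtain ⟨θ, hθ, hle⟩ := hW S (ε / 4) (by positivity)
  refine ⟨θ, hθ, ?_⟩
  obtain ⟨w, hw, hlt⟩ := (ContinuousLinearMap.id 𝕜 W + θ • S).exists_lt_apply_of_lt_opNorm
    (show 1 + ‖S‖ - ε / 2 < _ by linarith)
  have hg' : ‖J i w + f w • h‖ ≤ 1 := by
    have h2 := hJ i w (f w • g) hw.le (by
      rw [norm_smul]
      have h3 : ‖f w‖ ≤ 1 := by
        have := f.le_opNorm w
        rw [hf, one_mul] at this
        exact this.trans hw.le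
      exact mul_le_one₀ h3 (norm_nonneg _) hg)
    simpa [hh, smul_sub] using h2
  have h4 : P i ((ContinuousLinearMap.id 𝕜 G + θ • T) (J i w + f w • h)) =
      (ContinuousLinearMap.id 𝕜 W + θ • S) w := by
    simp [hS, hPJ, hPh]
  rw [← h4] at hlt
  have h5 := (ContinuousLinearMap.id 𝕜 G + θ • T).le_opNorm (J i w + f w • h)
  have h6 := mul_le_mul_of_nonneg_left hg' (norm_nonneg (ContinuousLinearMap.id 𝕜 G + θ • T))
  have h7 := hP i ((ContinuousLinearMap.id 𝕜 G + θ • T) (J i w + f w • h))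
  linarith

end MStructure

section LocalDuality

variable {𝕜 : Type*} [RCLike 𝕜] {Z : Type*} [NormedAddCommGroup Z] [NormedSpace 𝕜 Z]

theorem sum_norm_le_of_forall_unit {ι V : Type*} [NormedAddCommGroup V] [NormedSpace 𝕜 V]
    (s : Finset ι) (f : ι → StrongDual 𝕜 V) (C : ℝ)
    (h : ∀ x : ι → V, (∀ i, ‖x i‖ ≤ 1) → ‖∑ i ∈ s, f i (x i)‖ ≤ C) : ∑ i ∈ s, ‖f i‖ ≤ C := by
  refine le_of_forall_pos_le_add fun ε hε => ?_
  set δ := ε / (s.card + 1) with hδ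
  have hδ0 : 0 < δ := by positivity
  have hex : ∀ i, ∃ x : V, ‖x‖ ≤ 1 ∧ ∃ r : ℝ, ‖f i‖ - δ ≤ r ∧ f i x = (r : 𝕜) := by
    intro i
    obtain ⟨x, hx, hfx⟩ := (f i).exists_lt_apply_of_lt_opNorm (show ‖f i‖ - δ < ‖f i‖ by linarith)
    obtain ⟨θ, hθ, hθc⟩ := exists_norm_one_mul_eq_norm (f i x)
    exact ⟨θ • x, by rw [norm_smul, hθ, one_mul]; exact hx.le, ‖f i x‖, hfx.le, by simp [hθc]⟩
  choose x hx r hr hfx using hex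
  have h1 := h x hx
  simp only [hfx] at h1
  rw [← RCLike.ofReal_sum, RCLike.norm_ofReal] at h1
  have h2 : ∑ i ∈ s, (‖f i‖ - δ) ≤ ∑ i ∈ s, r i := Finset.sum_le_sum fun i _ => hr i
  rw [Finset.sum_sub_distrib, Finset.sum_const, nsmul_eq_mul] at h2
  have h3 : (s.card : ℝ) * δ ≤ ε := by
    rw [hδ, mul_div_assoc', div_le_iff₀ (by positivity)]
    nlinarith
  linarith [le_abs_self (∑ i ∈ s, r i)]

/-- A functional dominated by an operator `L` factors through `L`. -/
theorem exists_dual_comp_eq {U V : Type*} [NormedAddCommGroup V] [NormedSpace 𝕜 V]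
    [NormedAddCommGroup U] [NormedSpace 𝕜 U] (L : V →L[𝕜] U) (ψ : StrongDual 𝕜 V) (C : ℝ)
    (hC : 0 ≤ C) (h : ∀ v, ‖ψ v‖ ≤ C * ‖L v‖) :
    ∃ Ψ : StrongDual 𝕜 U, ‖Ψ‖ ≤ C ∧ ∀ v, Ψ (L v) = ψ v := by
  have hker : LinearMap.ker (L : V →ₗ[𝕜] U) ≤ LinearMap.ker (ψ : V →ₗ[𝕜] 𝕜) := by
    intro v hv
    have hv' : L v = 0 := hv
    have := h v
    rw [hv', norm_zero, mul_zero] at this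
    exact norm_le_zero_iff.1 this
  let g : LinearMap.range (L : V →ₗ[𝕜] U) →ₗ[𝕜] 𝕜 :=
    ((LinearMap.ker (L : V →ₗ[𝕜] U)).liftQ (ψ : V →ₗ[𝕜] 𝕜) hker) ∘ₗ
      ((L : V →ₗ[𝕜] U).quotKerEquivRange.symm : _ →ₗ[𝕜] _)
  have hg : ∀ v (hv : L v ∈ LinearMap.range (L : V →ₗ[𝕜] U)), g ⟨L v, hv⟩ = ψ v := by
    intro v hv
    have := (L : V →ₗ[𝕜] U).quotKerEquivRange_symm_apply_image v hv
    simp only [g, LinearMap.comp_apply, LinearEquiv.coe_coe]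
    erw [this]
    simp
  have hgb : ∀ y, ‖g y‖ ≤ C * ‖y‖ := by
    rintro ⟨_, v, rfl⟩
    erw [hg v]
    exact h v
  obtain ⟨Ψ, hΨ, hΨn⟩ := exists_extension_norm_eq _ (g.mkContinuous C hgb)
  refine ⟨Ψ, hΨn.le.trans (g.mkContinuous_norm_le hC hgb), fun v => ?_⟩
  rw [← hg v ⟨v, rfl⟩]
  exact hΨ ⟨L v, ⟨v, rfl⟩⟩

/-- The duality estimate behind the principle of local reflexivity for operators on `ℓ_∞^N`. -/
theorem norm_sum_bidual_apply_le {ι : Type*} [Fintype ι] (ψ : ι → StrongDual 𝕜 Z)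
    (a : ι → StrongDual 𝕜 (StrongDual 𝕜 Z)) (C : ℝ) (hC : 0 ≤ C)
    (ha : ∀ θ : ι → 𝕜, ‖θ‖ ≤ 1 → ‖∑ i, θ i • a i‖ ≤ 1)
    (hψ : ∀ w : ι → Z, (∀ θ : ι → 𝕜, ‖θ‖ ≤ 1 → ‖∑ i, θ i • w i‖ ≤ 1) → ‖∑ i, ψ i (w i)‖ ≤ C) :
    ‖∑ i, a i (ψ i)‖ ≤ C := by
  classical
  have key : ∀ ε : ℝ, 0 < ε → ε < 1 → ‖∑ i, a i (ψ i)‖ ≤ C / (1 - ε) := by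
    intro ε hε hε1
    have hε' : 0 < 1 - ε := by linarith
    obtain ⟨t, ht, htf, htc⟩ := (isCompact_closedBall (0 : ι → 𝕜) 1).finite_cover_balls hε
    have := htf.fintype
    let L : (ι → Z) →L[𝕜] (t → Z) := ContinuousLinearMap.pi fun θ =>
      ∑ i, (θ : ι → 𝕜) i • ContinuousLinearMap.proj (R := 𝕜) (φ := fun _ : ι => Z) i
    have hL : ∀ w θ, L w θ = ∑ i, (θ : ι → 𝕜) i • w i := fun w θ => by simp [L]
    have hsmall : ∀ w, ‖L w‖ ≤ 1 - ε → ‖∑ i, ψ i (w i)‖ ≤ C := by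
      intro w hw
      apply hψ w
      let Λ : (ι → 𝕜) →L[𝕜] Z :=
        ∑ i, (ContinuousLinearMap.proj (R := 𝕜) (φ := fun _ : ι => 𝕜) i).smulRight (w i)
      have hΛ : ∀ θ, Λ θ = ∑ i, θ i • w i := fun θ => by simp [Λ]
      have hΛn : ‖Λ‖ ≤ (1 - ε) + ‖Λ‖ * ε := by
        refine ContinuousLinearMap.opNorm_le_of_unit_norm (by positivity) fun θ hθ => ?_
        obtain ⟨θ₀, hθ₀, hd⟩ := Set.mem_iUnion₂.1 (htc (by simp [hθ] : θ ∈ _))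
        rw [Metric.mem_ball, dist_eq_norm] at hd
        have h1 : ‖Λ θ₀‖ ≤ 1 - ε := by
          have := (norm_le_pi_norm (L w) ⟨θ₀, hθ₀⟩).trans hw
          rwa [hL, ← hΛ] at this
        calc ‖Λ θ‖ = ‖Λ θ₀ + Λ (θ - θ₀)‖ := by rw [← map_add]; simp
          _ ≤ (1 - ε) + ‖Λ‖ * ε := by
            refine (norm_add_le _ _).trans (add_le_add h1 ((Λ.le_opNorm _).trans ?_))
            gcongr
      have hΛ1 : ‖Λ‖ ≤ 1 := by nlinarith
      intro θ hθ
      rw [← hΛ]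
      exact (Λ.le_opNorm θ).trans (mul_le_one₀ hΛ1 (norm_nonneg _) hθ)
    let ψ' : StrongDual 𝕜 (ι → Z) :=
      ∑ i, (ψ i) ∘L ContinuousLinearMap.proj (R := 𝕜) (φ := fun _ : ι => Z) i
    have hψ' : ∀ w, ψ' w = ∑ i, ψ i (w i) := fun w => by simp [ψ']
    have hbound : ∀ w, ‖ψ' w‖ ≤ C / (1 - ε) * ‖L w‖ := by
      intro w
      have h1 : ∀ δ : ℝ, 0 < δ → ‖ψ' w‖ ≤ C / (1 - ε) * (‖L w‖ + δ) := by
        intro δ hδ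
        set c : ℝ := (1 - ε) / (‖L w‖ + δ) with hc
        have hc0 : 0 < c := by positivity
        have h2 := hsmall ((c : 𝕜) • w) (by
          rw [map_smul, norm_smul, RCLike.norm_ofReal, abs_of_pos hc0, hc, div_mul_eq_mul_div,
            div_le_iff₀ (by positivity)]
          gcongr
          linarith)
        rw [← hψ', map_smul, norm_smul, RCLike.norm_ofReal, abs_of_pos hc0, hc,
          div_mul_eq_mul_div, div_le_iff₀ (by positivity)] at h2
        rw [div_mul_eq_mul_div, le_div_iff₀ hε']
        linarith
      have h2 : Filter.Tendsto (fun δ : ℝ => C / (1 - ε) * (‖L w‖ + δ)) (nhdsWithin 0 (Set.Ioi 0))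
          (nhds (C / (1 - ε) * (‖L w‖ + 0))) :=
        (Continuous.tendsto (by fun_prop) 0).mono_left nhdsWithin_le_nhds
      rw [add_zero] at h2
      exact ge_of_tendsto h2 (by filter_upwards [self_mem_nhdsWithin] with δ hδ using h1 δ hδ)
    obtain ⟨Ψ, hΨn, hΨ⟩ := exists_dual_comp_eq L ψ' (C / (1 - ε)) (by positivity) hbound
    let ζ : t → StrongDual 𝕜 Z := fun θ => Ψ ∘L ContinuousLinearMap.single 𝕜 (fun _ : t => Z) θ
    have hΨsum : ∀ x : t → Z, Ψ x = ∑ θ, ζ θ (x θ) := by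
      intro x
      conv_lhs => rw [← Finset.univ_sum_single x]
      simp [ζ]
    have hζ : ∑ θ, ‖ζ θ‖ ≤ C / (1 - ε) := by
      refine sum_norm_le_of_forall_unit _ _ _ fun x hx => ?_
      rw [← hΨsum]
      have h1 : ‖x‖ ≤ 1 := (pi_norm_le_iff_of_nonneg zero_le_one).2 hx
      exact (Ψ.le_opNorm x).trans ((mul_le_of_le_one_right (norm_nonneg _) h1).trans hΨn)
    have hψζ : ∀ i, ψ i = ∑ θ : t, (θ : ι → 𝕜) i • ζ θ := by
      intro i
      ext z
      have h1 : ψ' (Pi.single i z) = ψ i z := by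
        rw [hψ', Finset.sum_eq_single i] <;> simp +contextual
      rw [← h1, ← hΨ, hΨsum]
      simp [hL, Pi.single_apply]
    calc ‖∑ i, a i (ψ i)‖ = ‖∑ θ : t, (∑ i, (θ : ι → 𝕜) i • a i) (ζ θ)‖ := by
          congr 1
          simp only [hψζ, map_sum, map_smul, sum_apply, smul_apply]
          exact Finset.sum_comm
      _ ≤ ∑ θ : t, ‖ζ θ‖ := by
          refine norm_sum_le_of_le _ fun θ _ => ?_
          refine (ContinuousLinearMap.le_opNorm _ _).trans
            (mul_le_of_le_one_left (norm_nonneg _) (ha _ ?_))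
          simpa using ht θ.2
      _ ≤ C / (1 - ε) := hζ
  have hlim : Filter.Tendsto (fun ε : ℝ => C / (1 - ε)) (nhdsWithin 0 (Set.Ioi 0))
      (nhds (C / (1 - 0))) :=
    (ContinuousAt.tendsto (by fun_prop (disch := norm_num))).mono_left nhdsWithin_le_nhds
  rw [sub_zero, div_one] at hlim
  refine ge_of_tendsto hlim ?_
  filter_upwards [Ioo_mem_nhdsGT (zero_lt_one' ℝ)] with ε hε using key ε hε.1 hε.2

end LocalDuality

theorem sum_norm_apply_le_norm_lp_one {𝕜 : Type*} [RCLike 𝕜] (a : SeqL1 𝕜) (s : Finset ℕ) :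
    ∑ i ∈ s, ‖a i‖ ≤ ‖a‖ := by
  simpa using lp.sum_rpow_le_norm_rpow (p := 1) (by simp) a s

section LStructure

variable {𝕜 : Type*} [RCLike 𝕜] {F V : Type*} [NormedAddCommGroup F] [NormedSpace 𝕜 F]
  [NormedAddCommGroup V] [NormedSpace 𝕜 V]

/-- If `F` is an `ℓ₁`-sum of copies of `V` and `V*` has the alternative Daugavet property, so does
`F*`. -/
theorem AlternativeDaugavet.dual_of_lSummands (hV : AlternativeDaugavet 𝕜 (StrongDual 𝕜 V))
    (p : ℕ → F →L[𝕜] V) (j : ℕ → V →L[𝕜] F) (hpj : ∀ i v, p i (j i v) = v)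
    (hj : ∀ i v, ‖j i v‖ ≤ ‖v‖) (hp : ∀ (s : Finset ℕ) φ, ∑ i ∈ s, ‖p i φ‖ ≤ ‖φ‖)
    (hsum : ∀ φ, HasSum (fun i => j i (p i φ)) φ) :
    AlternativeDaugavet 𝕜 (StrongDual 𝕜 F) := by
  refine hV.of_mSummands (fun i => dualOperator (j i)) (fun i => dualOperator (p i)) ?_ ?_ ?_ ?_
  · intro i w
    ext v
    simp [dualOperator_apply, hpj]
  · intro i g
    refine ContinuousLinearMap.opNorm_le_bound _ (norm_nonneg _) fun v => ?_
    exact (g.le_opNorm _).trans (by gcongr; exact hj i v)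
  · intro i w g hw hg
    refine ContinuousLinearMap.opNorm_le_bound _ zero_le_one fun φ => ?_
    have h1 : ‖φ - j i (p i φ)‖ ≤ ‖φ‖ - ‖p i φ‖ := by
      refine le_of_tendsto ((hsum φ).sub_const (j i (p i φ))).norm ?_
      filter_upwards [Filter.eventually_ge_atTop {i}] with s hs
      have hi : i ∈ s := by simpa using hs
      rw [← Finset.add_sum_erase s _ hi, add_sub_cancel_left]
      have h2 := hp s φ
      rw [← Finset.add_sum_erase s _ hi] at h2
      have h3 : ‖∑ k ∈ s.erase i, j k (p k φ)‖ ≤ ∑ k ∈ s.erase i, ‖p k φ‖ :=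
        norm_sum_le_of_le _ fun k _ => hj k _
      linarith
    calc ‖w (p i φ) + (g φ - g (j i (p i φ)))‖ = ‖w (p i φ) + g (φ - j i (p i φ))‖ := by
          rw [map_sub]
      _ ≤ 1 * ‖p i φ‖ + 1 * (‖φ‖ - ‖p i φ‖) := by
          refine (norm_add_le _ _).trans (add_le_add ?_ ?_)
          · exact (w.le_opNorm _).trans (by gcongr)
          · exact (g.le_opNorm _).trans (by gcongr)
      _ = 1 * ‖φ‖ := by ring
  · intro g C hC h
    refine ContinuousLinearMap.opNorm_le_bound _ hC fun φ => ?_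
    refine le_of_tendsto ((hsum φ).mapL g).norm (Filter.Eventually.of_forall fun s => ?_)
    calc ‖∑ k ∈ s, g (j k (p k φ))‖ ≤ ∑ k ∈ s, C * ‖p k φ‖ :=
          norm_sum_le_of_le _ fun k _ =>
            ((dualOperator (j k) g).le_opNorm (p k φ)).trans (by gcongr; exact h k)
      _ ≤ C * ‖φ‖ := by rw [← Finset.mul_sum]; gcongr; exact hp s φ

end LStructure

section Predual

variable {𝕜 : Type*} [RCLike 𝕜] {Z : Type*} [NormedAddCommGroup Z] [NormedSpace 𝕜 Z]

/-- The coordinate functionals on the dual of a predual of `ℓ₁`. -/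
noncomputable def dualCoord (e : StrongDual 𝕜 Z ≃ₗᵢ[𝕜] SeqL1 𝕜) (i : ℕ) :
    StrongDual 𝕜 (StrongDual 𝕜 Z) :=
  lp.evalCLM 𝕜 (fun _ : ℕ => 𝕜) 1 i ∘L (e.toContinuousLinearEquiv : StrongDual 𝕜 Z →L[𝕜] SeqL1 𝕜)

/-- The functionals on a predual of `ℓ₁` corresponding to the unit vectors of `ℓ₁`. -/
noncomputable def dualUnit (e : StrongDual 𝕜 Z ≃ₗᵢ[𝕜] SeqL1 𝕜) (i : ℕ) : StrongDual 𝕜 Z :=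
  e.symm (lp.single 1 i 1)

variable (e : StrongDual 𝕜 Z ≃ₗᵢ[𝕜] SeqL1 𝕜)

theorem dualCoord_apply (i : ℕ) (f : StrongDual 𝕜 Z) : dualCoord e i f = e f i := rfl

theorem dualCoord_dualUnit_self (i : ℕ) : dualCoord e i (dualUnit e i) = 1 := by
  rw [dualCoord_apply, dualUnit, LinearIsometryEquiv.apply_symm_apply]
  exact lp.single_apply_self (E := fun _ : ℕ => 𝕜) 1 i 1

theorem norm_dualUnit (i : ℕ) : ‖dualUnit e i‖ = 1 := by
  rw [dualUnit, LinearIsometryEquiv.norm_map, lp.norm_single (by simp), norm_one]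

theorem sum_norm_dualCoord_le (s : Finset ℕ) (f : StrongDual 𝕜 Z) :
    ∑ i ∈ s, ‖dualCoord e i f‖ ≤ ‖f‖ := by
  rw [← e.norm_map f]
  exact sum_norm_apply_le_norm_lp_one (e f) s

theorem hasSum_dualCoord_smul_dualUnit (f : StrongDual 𝕜 Z) :
    HasSum (fun i => dualCoord e i f • dualUnit e i) f := by
  have h1 := lp.hasSum_single (p := 1) (by simp) (e f)
  have h2 := h1.mapL (e.symm.toContinuousLinearEquiv : SeqL1 𝕜 →L[𝕜] StrongDual 𝕜 Z)
  simp only [ContinuousLinearEquiv.coe_coe, LinearIsometryEquiv.coe_toContinuousLinearEquiv,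
    LinearIsometryEquiv.symm_apply_apply] at h2
  have h3 : (fun i => dualCoord e i f • dualUnit e i) =
      fun i => e.symm (lp.single (E := fun _ : ℕ => 𝕜) 1 i (e f i)) := by
    funext i
    rw [dualCoord_apply, dualUnit, ← map_smul, ← lp.single_smul, smul_eq_mul, mul_one]
  rw [h3]
  exact h2

theorem norm_sum_smul_dualCoord_le (s : Finset ℕ) (θ : s → 𝕜) (hθ : ‖θ‖ ≤ 1) :
    ‖∑ i : s, θ i • dualCoord e i‖ ≤ 1 := by
  refine ContinuousLinearMap.opNorm_le_bound _ zero_le_one fun f => ?_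
  rw [one_mul, sum_apply]
  refine le_trans ?_ (sum_norm_dualCoord_le e s f)
  rw [← Finset.sum_coe_sort s]
  refine norm_sum_le_of_le _ fun i _ => ?_
  rw [smul_apply, norm_smul]
  exact mul_le_of_le_one_left (norm_nonneg _) ((norm_le_pi_norm θ i).trans hθ)

/-- Operators `∑ θᵢ wᵢ` with small norm control the diagonal of a family of functionals. -/
theorem norm_sum_dualCoord_le (s : Finset ℕ) (ψ : ℕ → StrongDual 𝕜 Z) (C : ℝ) (hC : 0 ≤ C)
    (hψ : ∀ w : s → Z, (∀ θ : s → 𝕜, ‖θ‖ ≤ 1 → ‖∑ i, θ i • w i‖ ≤ 1) →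
      ‖∑ i : s, ψ i (w i)‖ ≤ C) :
    ‖∑ i ∈ s, dualCoord e i (ψ i)‖ ≤ C := by
  rw [← Finset.sum_coe_sort s]
  exact norm_sum_bidual_apply_le (fun i : s => ψ i) (fun i : s => dualCoord e i) C hC
    (norm_sum_smul_dualCoord_le e s) hψ

/-- The metric approximation property of a predual of `ℓ₁`. -/
theorem exists_finiteRank_approx (e : StrongDual 𝕜 Z ≃ₗᵢ[𝕜] SeqL1 𝕜) {κ : Type*} [Fintype κ] (z : κ → Z) (ε : ℝ) (hε : 0 < ε) :
    ∃ R : Z →L[𝕜] Z, ‖R‖ ≤ 1 ∧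
      R ∈ Submodule.span 𝕜 {S : Z →L[𝕜] Z | ∃ (f : StrongDual 𝕜 Z) (w : Z), S = f.smulRight w} ∧
      ∀ k, ‖R (z k) - z k‖ < ε := by
  classical
  set M := Submodule.span 𝕜
    {S : Z →L[𝕜] Z | ∃ (f : StrongDual 𝕜 Z) (w : Z), S = f.smulRight w} with hM
  let : NormedSpace ℝ (κ → Z) := NormedSpace.restrictScalars ℝ 𝕜 (κ → Z)
  have : IsScalarTower ℝ 𝕜 (κ → Z) := IsScalarTower.of_algebraMap_smul fun r x => rfl
  let A : Set (κ → Z) := {x | ∃ R : Z →L[𝕜] Z, ‖R‖ ≤ 1 ∧ R ∈ M ∧ ∀ k, x k = R (z k)}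
  by_cases hz : z ∈ closure A
  · obtain ⟨x, ⟨R, hR, hRM, hx⟩, hd⟩ := Metric.mem_closure_iff.1 hz ε hε
    refine ⟨R, hR, hRM, fun k => ?_⟩
    rw [← hx, ← dist_eq_norm, dist_comm]
    exact (dist_le_pi_dist z x k).trans_lt hd
  exfalso
  have hA : Convex ℝ A := by
    rintro x ⟨R, hR, hRM, hx⟩ y ⟨S, hS, hSM, hy⟩ a b ha hb hab
    refine ⟨(a : 𝕜) • R + (b : 𝕜) • S, ?_, M.add_mem (M.smul_mem _ hRM) (M.smul_mem _ hSM), ?_⟩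
    · calc ‖(a : 𝕜) • R + (b : 𝕜) • S‖ ≤ a * ‖R‖ + b * ‖S‖ := by
            refine (norm_add_le _ _).trans ?_
            rw [norm_smul, norm_smul, RCLike.norm_ofReal, RCLike.norm_ofReal, abs_of_nonneg ha,
              abs_of_nonneg hb]
        _ ≤ a * 1 + b * 1 := by gcongr
        _ = 1 := by rw [mul_one, mul_one, hab]
    · intro k
      have : (a • x + b • y) = (a : 𝕜) • x + (b : 𝕜) • y := by
        rw [← algebraMap_smul 𝕜 a x, ← algebraMap_smul 𝕜 b y]
      rw [this]
      change (a : 𝕜) • x k + (b : 𝕜) • y k = (a : 𝕜) • R (z k) + (b : 𝕜) • S (z k)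
      rw [hx, hy]
  obtain ⟨g, u, hgA, hgz⟩ := RCLike.geometric_hahn_banach_closed_point (𝕜 := 𝕜) hA.closure
    isClosed_closure hz
  have hu : ∀ x ∈ A, ‖g x‖ ≤ u := by
    rintro x ⟨R, hR, hRM, hx⟩
    obtain ⟨θ, hθ, hθc⟩ := exists_norm_one_mul_eq_norm (g x)
    have h1 := hgA (θ • x) (subset_closure ⟨θ • R, by rw [norm_smul, hθ, one_mul]; exact hR,
      M.smul_mem _ hRM, fun k => by simp [hx]⟩)
    rw [map_smul, smul_eq_mul, hθc, RCLike.ofReal_re] at h1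
    exact h1.le
  have hu0 : 0 ≤ u := (norm_nonneg _).trans (hu 0 ⟨0, by simp, M.zero_mem, by simp⟩)
  let γ : κ → StrongDual 𝕜 Z := fun k => g ∘L ContinuousLinearMap.single 𝕜 (fun _ : κ => Z) k
  have hγ : ∀ x, g x = ∑ k, γ k (x k) := by
    intro x
    conv_lhs => rw [← Finset.univ_sum_single x]
    simp [γ]
  have hpart : ∀ s : Finset ℕ, ‖∑ j ∈ s, dualCoord e j (∑ k, dualUnit e j (z k) • γ k)‖ ≤ u := by
    intro s
    refine norm_sum_dualCoord_le e s (fun j => ∑ k, dualUnit e j (z k) • γ k) u hu0 fun w hw => ?_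
    have h1 := hu (fun k => (∑ j : s, (dualUnit e j).smulRight (w j)) (z k))
      ⟨∑ j : s, (dualUnit e j).smulRight (w j), ?_, ?_, fun k => rfl⟩
    · rw [hγ] at h1
      simp only [sum_apply, ContinuousLinearMap.smulRight_apply, map_sum, map_smul] at h1
      rw [Finset.sum_comm] at h1
      simpa [sum_apply] using h1
    · refine ContinuousLinearMap.opNorm_le_of_unit_norm zero_le_one fun x hx => ?_
      have h2 := hw (fun j => dualUnit e j x) ((pi_norm_le_iff_of_nonneg zero_le_one).2 fun j => by
        simpa [norm_dualUnit, hx] using (dualUnit e j).le_opNorm x)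
      simpa [sum_apply] using h2
    · exact M.sum_mem fun j _ => Submodule.subset_span ⟨_, _, rfl⟩
  have hlim : HasSum (fun j => dualCoord e j (∑ k, dualUnit e j (z k) • γ k)) (g z) := by
    have h1 : ∀ k, HasSum (fun j => dualCoord e j (γ k) * dualUnit e j (z k)) (γ k (z k)) := by
      intro k
      have := (hasSum_dualCoord_smul_dualUnit e (γ k)).mapL (ContinuousLinearMap.apply 𝕜 𝕜 (z k))
      simpa using this
    have h2 := hasSum_sum fun k (_ : k ∈ Finset.univ) => h1 k
    rw [hγ]
    convert h2 using 2 with j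
    simp [map_sum, mul_comm]
  have h3 := le_of_tendsto hlim.norm (Filter.Eventually.of_forall hpart)
  exact absurd ((RCLike.re_le_norm (g z)).trans h3) (not_le.2 hgz)

end Predual

section CompactOperators

variable {𝕜 : Type*} [RCLike 𝕜] {X Z : Type*} [NormedAddCommGroup X] [NormedSpace 𝕜 X]
  [NormedAddCommGroup Z] [NormedSpace 𝕜 Z]

theorem isCompactOperator_smulRight (f : StrongDual 𝕜 X) (z : Z) :
    IsCompactOperator (f.smulRight z) := by
  have h : IsCompactOperator (id : 𝕜 → 𝕜) :=
    isCompactOperator_id_iff_finiteDimensional (𝕜 := 𝕜).2 inferInstance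
  exact (h.comp_clm f).clm_comp ((ContinuousLinearMap.id 𝕜 𝕜).smulRight z)

/-- The rank one operators, as a bounded bilinear map into the compact operators. -/
noncomputable def rankOne (𝕜 : Type*) [RCLike 𝕜] (X Z : Type*) [NormedAddCommGroup X]
    [NormedSpace 𝕜 X] [NormedAddCommGroup Z] [NormedSpace 𝕜 Z] :
    StrongDual 𝕜 X →L[𝕜] Z →L[𝕜] CompactOps 𝕜 X Z :=
  LinearMap.mkContinuous₂
    (LinearMap.mk₂ 𝕜 (fun f z => (⟨f.smulRight z, isCompactOperator_smulRight f z⟩ : CompactOps 𝕜 X Z))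
      (fun f g z => by ext x; simp [add_smul])
      (fun c f z => by ext x; simp [mul_smul])
      (fun f z w => by ext x; simp [smul_add])
      (fun c f z => by ext x; exact smul_comm (f x) c z)) 1
    (fun f z => by
      rw [one_mul]
      exact (ContinuousLinearMap.norm_smulRight_apply f z).le)

theorem coe_rankOne (f : StrongDual 𝕜 X) (z : Z) :
    (rankOne 𝕜 X Z f z : X →L[𝕜] Z) = f.smulRight z := rfl

variable (e : StrongDual 𝕜 Z ≃ₗᵢ[𝕜] SeqL1 𝕜)

theorem exists_span_rankOne_approx (e : StrongDual 𝕜 Z ≃ₗᵢ[𝕜] SeqL1 𝕜) (T : CompactOps 𝕜 X Z)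
    (ε : ℝ) (hε : 0 < ε) :
    ∃ S ∈ Submodule.span 𝕜 {S : CompactOps 𝕜 X Z | ∃ f z, S = rankOne 𝕜 X Z f z}, ‖S - T‖ ≤ ε := by
  have hcomp : IsCompact (closure ((T : X →L[𝕜] Z) '' Metric.closedBall 0 1)) :=
    IsCompactOperator.isCompact_closure_image_closedBall (f := ((T : X →L[𝕜] Z) : X →ₗ[𝕜] Z)) T.2 1
  obtain ⟨t, -, htf, htc⟩ := hcomp.finite_cover_balls (show 0 < ε / 3 by positivity)
  have := htf.fintype
  obtain ⟨R, hR, hRM, hRz⟩ := exists_finiteRank_approx e (fun k : t => (k : Z)) (ε / 3)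
    (by positivity)
  have hspan : ∀ R ∈ Submodule.span 𝕜
      {S : Z →L[𝕜] Z | ∃ (f : StrongDual 𝕜 Z) (w : Z), S = f.smulRight w},
      ∃ S ∈ Submodule.span 𝕜 {S : CompactOps 𝕜 X Z | ∃ f z, S = rankOne 𝕜 X Z f z},
        (S : X →L[𝕜] Z) = R ∘L (T : X →L[𝕜] Z) := by
    intro R hR
    induction hR using Submodule.span_induction with
    | mem R h =>
      obtain ⟨f, w, rfl⟩ := h
      refine ⟨rankOne 𝕜 X Z (f ∘L (T : X →L[𝕜] Z)) w, Submodule.subset_span ⟨_, _, rfl⟩, ?_⟩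
      rfl
    | zero => exact ⟨0, Submodule.zero_mem _, by simp⟩
    | add R₁ R₂ _ _ h₁ h₂ =>
      obtain ⟨S₁, hS₁, h₁⟩ := h₁
      obtain ⟨S₂, hS₂, h₂⟩ := h₂
      exact ⟨S₁ + S₂, Submodule.add_mem _ hS₁ hS₂, by
        rw [Submodule.coe_add, h₁, h₂, ContinuousLinearMap.add_comp]⟩
    | smul c R _ h =>
      obtain ⟨S, hS, h⟩ := h
      exact ⟨c • S, Submodule.smul_mem _ _ hS, by
        rw [Submodule.coe_smul, h, ContinuousLinearMap.smul_comp]⟩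
  obtain ⟨S, hS, hSR⟩ := hspan R hRM
  refine ⟨S, hS, ?_⟩
  change ‖(S : X →L[𝕜] Z) - (T : X →L[𝕜] Z)‖ ≤ ε
  rw [hSR]
  refine ContinuousLinearMap.opNorm_le_of_unit_norm hε.le fun x hx => ?_
  obtain ⟨z, hz, hd⟩ := Set.mem_iUnion₂.1
    (htc (subset_closure (Set.mem_image_of_mem _ (by simp [hx] : x ∈ Metric.closedBall 0 1))))
  rw [Metric.mem_ball, dist_eq_norm] at hd
  set y := (T : X →L[𝕜] Z) x
  have h1 : ‖R (y - z)‖ ≤ ε / 3 :=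
    (R.le_opNorm _).trans ((mul_le_of_le_one_left (norm_nonneg _) hR).trans hd.le)
  have h2 := hRz ⟨z, hz⟩
  calc ‖R y - y‖ = ‖R (y - z) + (R z - z) - (y - z)‖ := by rw [map_sub]; congr 1; abel
    _ ≤ ε / 3 + ε / 3 + ε / 3 :=
      (norm_sub_le _ _).trans (add_le_add ((norm_add_le _ _).trans (add_le_add h1 h2.le)) hd.le)
    _ = ε := by ring

/-- The component maps `K(X, Z)* → X**` of the identification of `K(X, Z)*` with `ℓ₁(X**)`. -/
noncomputable def dualComponent (i : ℕ) :
    StrongDual 𝕜 (CompactOps 𝕜 X Z) →L[𝕜] StrongDual 𝕜 (StrongDual 𝕜 X) :=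
  ContinuousLinearMap.compL 𝕜 (StrongDual 𝕜 X) (StrongDual 𝕜 Z) 𝕜 (dualCoord e i) ∘L
    (ContinuousLinearMap.compL 𝕜 (StrongDual 𝕜 X) (Z →L[𝕜] CompactOps 𝕜 X Z)
      (StrongDual 𝕜 Z)).flip (rankOne 𝕜 X Z) ∘L
    ContinuousLinearMap.compL 𝕜 Z (CompactOps 𝕜 X Z) 𝕜

theorem dualComponent_apply (i : ℕ) (φ : StrongDual 𝕜 (CompactOps 𝕜 X Z)) (f : StrongDual 𝕜 X) :
    dualComponent e i φ f = dualCoord e i (φ ∘L rankOne 𝕜 X Z f) := rfl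

/-- The embeddings `X** → K(X, Z)*` of the identification of `K(X, Z)*` with `ℓ₁(X**)`. -/
noncomputable def dualEmbedding (i : ℕ) :
    StrongDual 𝕜 (StrongDual 𝕜 X) →L[𝕜] StrongDual 𝕜 (CompactOps 𝕜 X Z) :=
  dualOperator (ContinuousLinearMap.compL 𝕜 X Z 𝕜 (dualUnit e i) ∘L
    (compactOperator (RingHom.id 𝕜) X Z).subtypeL)

theorem dualEmbedding_apply (i : ℕ) (v : StrongDual 𝕜 (StrongDual 𝕜 X)) (T : CompactOps 𝕜 X Z) :
    dualEmbedding e i v T = v (dualUnit e i ∘L (T : X →L[𝕜] Z)) := rfl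

theorem dualEmbedding_comp_rankOne (i : ℕ) (v : StrongDual 𝕜 (StrongDual 𝕜 X))
    (f : StrongDual 𝕜 X) :
    dualEmbedding e i v ∘L rankOne 𝕜 X Z f = v f • dualUnit e i := by
  ext z
  have : dualUnit e i ∘L (rankOne 𝕜 X Z f z : X →L[𝕜] Z) = dualUnit e i z • f := by
    ext x
    simp [coe_rankOne, mul_comm]
  rw [ContinuousLinearMap.comp_apply, dualEmbedding_apply, this]
  simp [mul_comm]

theorem dualComponent_dualEmbedding (i : ℕ) (v : StrongDual 𝕜 (StrongDual 𝕜 X)) :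
    dualComponent (X := X) e i (dualEmbedding e i v) = v := by
  ext f
  rw [dualComponent_apply, dualEmbedding_comp_rankOne, map_smul, dualCoord_dualUnit_self,
    smul_eq_mul, mul_one]

theorem norm_dualEmbedding_le (i : ℕ) (v : StrongDual 𝕜 (StrongDual 𝕜 X)) :
    ‖dualEmbedding (X := X) e i v‖ ≤ ‖v‖ := by
  refine ContinuousLinearMap.opNorm_le_bound _ (norm_nonneg _) fun T => ?_
  rw [dualEmbedding_apply]
  refine (v.le_opNorm _).trans (mul_le_mul_of_nonneg_left ?_ (norm_nonneg _))
  refine (ContinuousLinearMap.opNorm_comp_le _ _).trans ?_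
  rw [norm_dualUnit, one_mul]
  rfl

theorem sum_norm_dualComponent_le (s : Finset ℕ) (φ : StrongDual 𝕜 (CompactOps 𝕜 X Z)) :
    ∑ i ∈ s, ‖dualComponent e i φ‖ ≤ ‖φ‖ := by
  refine sum_norm_le_of_forall_unit s _ _ fun f hf => ?_
  refine norm_sum_dualCoord_le e s (fun i => φ ∘L rankOne 𝕜 X Z (f i)) ‖φ‖ (norm_nonneg _)
    fun w hw => ?_
  have h1 : ∑ i : s, (φ ∘L rankOne 𝕜 X Z (f i)) (w i) = φ (∑ i : s, rankOne 𝕜 X Z (f i) (w i)) := by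
    simp
  rw [h1]
  refine (φ.le_opNorm _).trans (mul_le_of_le_one_right (norm_nonneg _) ?_)
  change ‖((∑ i : s, rankOne 𝕜 X Z (f i) (w i) : CompactOps 𝕜 X Z) : X →L[𝕜] Z)‖ ≤ 1
  refine ContinuousLinearMap.opNorm_le_of_unit_norm zero_le_one fun x hx => ?_
  have h2 := hw (fun i => f i x) ((pi_norm_le_iff_of_nonneg zero_le_one).2 fun i => by
    have := (f i).le_opNorm x
    rw [hx, mul_one] at this
    exact this.trans (hf i))
  simpa [Submodule.coe_sum, sum_apply, coe_rankOne] using h2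

theorem hasSum_dualEmbedding_dualComponent (φ : StrongDual 𝕜 (CompactOps 𝕜 X Z)) :
    HasSum (fun i => dualEmbedding e i (dualComponent e i φ)) φ := by
  have hs : Summable fun i => ‖dualComponent e i φ‖ :=
    summable_of_sum_le (fun _ => norm_nonneg _) fun s => sum_norm_dualComponent_le e s φ
  have hs' : Summable fun i => dualEmbedding e i (dualComponent e i φ) :=
    Summable.of_norm_bounded hs fun i => norm_dualEmbedding_le e i _
  obtain ⟨Φ, hΦ⟩ := hs'
  suffices Φ = φ by rwa [this] at hΦ
  have hrank : ∀ f z, Φ (rankOne 𝕜 X Z f z) = φ (rankOne 𝕜 X Z f z) := by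
    intro f z
    have h1 := hΦ.mapL (ContinuousLinearMap.apply 𝕜 𝕜 (rankOne 𝕜 X Z f z))
    have h2 := (hasSum_dualCoord_smul_dualUnit e (φ ∘L rankOne 𝕜 X Z f)).mapL
      (ContinuousLinearMap.apply 𝕜 𝕜 z)
    refine h1.unique ?_
    have h3 : (fun i => dualEmbedding e i (dualComponent e i φ) (rankOne 𝕜 X Z f z)) =
        fun i => (dualCoord e i (φ ∘L rankOne 𝕜 X Z f) • dualUnit e i) z := by
      funext i
      exact DFunLike.congr_fun (dualEmbedding_comp_rankOne e i (dualComponent e i φ) f) z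
    change HasSum (fun i => dualEmbedding e i (dualComponent e i φ) (rankOne 𝕜 X Z f z)) _
    rw [h3]
    exact h2
  refine ContinuousLinearMap.ext_on (s := {S | ∃ f z, S = rankOne 𝕜 X Z f z}) ?_ ?_
  · intro T
    refine Metric.mem_closure_iff.2 fun ε hε => ?_
    obtain ⟨S, hS, hd⟩ := exists_span_rankOne_approx e T (ε / 2) (by positivity)
    refine ⟨S, hS, ?_⟩
    rw [dist_comm, dist_eq_norm]
    linarith
  · rintro _ ⟨f, z, rfl⟩
    exact hrank f z

theorem alternativeDaugavet_bidual_compactOps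
    (hX : AlternativeDaugavet 𝕜 (StrongDual 𝕜 (StrongDual 𝕜 (StrongDual 𝕜 X))))
    (hZ : IsIsometricPredualL1 𝕜 Z) :
    AlternativeDaugavet 𝕜 (StrongDual 𝕜 (StrongDual 𝕜 (CompactOps 𝕜 X Z))) := by
  obtain ⟨e⟩ := hZ
  exact hX.dual_of_lSummands (dualComponent e) (dualEmbedding e) (dualComponent_dualEmbedding e)
    (norm_dualEmbedding_le e) (sum_norm_dualComponent_le e) (hasSum_dualEmbedding_dualComponent e)

end CompactOperators

section SequenceSpaces

open scoped BoundedContinuousFunction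

variable {𝕜 : Type*} [RCLike 𝕜]

/-- Mutually inverse linear contractions are isometries. -/
noncomputable def isometryOfContractions {V W : Type*} [NormedAddCommGroup V] [NormedSpace 𝕜 V]
    [NormedAddCommGroup W] [NormedSpace 𝕜 W] (P : V →ₗ[𝕜] W) (Q : W →ₗ[𝕜] V)
    (hP : ∀ v, ‖P v‖ ≤ ‖v‖) (hQ : ∀ w, ‖Q w‖ ≤ ‖w‖) (hPQ : ∀ w, P (Q w) = w)
    (hQP : ∀ v, Q (P v) = v) : V ≃ₗᵢ[𝕜] W where
  toLinearEquiv := LinearEquiv.ofLinearMap P Q (LinearMap.ext hPQ) (LinearMap.ext hQP)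
  norm_map' v := le_antisymm (hP v) (by simpa [hQP] using hQ (P v))

theorem summable_norm_mul_bounded (a : SeqL1 𝕜) (b : ℕ →ᵇ 𝕜) : Summable fun i => ‖a i * b i‖ := by
  have h : Summable fun i => ‖a i‖ := by simpa using (lp.memℓp a).summable (by simp)
  refine Summable.of_nonneg_of_le (fun _ => norm_nonneg _) (fun i => ?_) (h.mul_right ‖b‖)
  rw [norm_mul]
  gcongr
  exact b.norm_coe_le_norm i

theorem norm_tsum_mul_le (a : SeqL1 𝕜) (b : ℕ →ᵇ 𝕜) : ‖∑' i, a i * b i‖ ≤ ‖a‖ * ‖b‖ := by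
  have h : HasSum (fun i => ‖a i‖) ‖a‖ := by simpa using lp.hasSum_norm (p := 1) (by simp) a
  refine tsum_of_norm_bounded (h.mul_right ‖b‖) fun i => ?_
  rw [norm_mul]
  gcongr
  exact b.norm_coe_le_norm i

/-- The pairing `∑ aᵢ bᵢ` of summable and bounded sequences. -/
noncomputable def seqPairing (𝕜 : Type*) [RCLike 𝕜] : SeqL1 𝕜 →L[𝕜] (ℕ →ᵇ 𝕜) →L[𝕜] 𝕜 :=
  LinearMap.mkContinuous₂
    (LinearMap.mk₂ 𝕜 (fun (a : SeqL1 𝕜) (b : ℕ →ᵇ 𝕜) => ∑' i, a i * b i)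
      (fun a a' b => by
        rw [← ((summable_norm_mul_bounded a b).of_norm).tsum_add
          ((summable_norm_mul_bounded a' b).of_norm)]
        exact tsum_congr fun i => by rw [lp.coeFn_add, Pi.add_apply, add_mul])
      (fun c a b => by
        rw [smul_eq_mul, ← tsum_mul_left]
        exact tsum_congr fun i => by rw [lp.coeFn_smul, Pi.smul_apply, smul_eq_mul, mul_assoc])
      (fun a b b' => by
        rw [← ((summable_norm_mul_bounded a b).of_norm).tsum_add
          ((summable_norm_mul_bounded a b').of_norm)]
        exact tsum_congr fun i => by rw [BoundedContinuousFunction.add_apply, mul_add])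
      (fun c a b => by
        rw [smul_eq_mul, ← tsum_mul_left]
        exact tsum_congr fun i => by
          rw [BoundedContinuousFunction.smul_apply, smul_eq_mul, mul_left_comm])) 1
    (fun a b => by rw [one_mul]; exact norm_tsum_mul_le a b)

theorem norm_seqPairing_apply_le (a : SeqL1 𝕜) (b : ℕ →ᵇ 𝕜) :
    ‖seqPairing 𝕜 a b‖ ≤ ‖a‖ * ‖b‖ :=
  norm_tsum_mul_le a b

/-- The dual of `ℓ₁` is the space of bounded sequences. -/
noncomputable def dualSeqL1 (𝕜 : Type*) [RCLike 𝕜] : (ℕ →ᵇ 𝕜) ≃ₗᵢ[𝕜] StrongDual 𝕜 (SeqL1 𝕜) :=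
  have hbound : ∀ (f : StrongDual 𝕜 (SeqL1 𝕜)) i, ‖f (lp.single 1 i 1)‖ ≤ ‖f‖ := fun f i => by
    refine (f.le_opNorm _).trans ?_
    rw [lp.norm_single (by simp), norm_one, mul_one]
  isometryOfContractions ((seqPairing 𝕜).flip : (ℕ →ᵇ 𝕜) →ₗ[𝕜] StrongDual 𝕜 (SeqL1 𝕜))
    { toFun := fun f => BoundedContinuousFunction.ofNormedAddCommGroupDiscrete
        (fun i => f (lp.single 1 i 1)) ‖f‖ (hbound f)
      map_add' := fun f g => by ext i; simp
      map_smul' := fun c f => by ext i; simp }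
    (fun b => ContinuousLinearMap.opNorm_le_bound _ (norm_nonneg _) fun a => by
      rw [mul_comm]; exact norm_seqPairing_apply_le a b)
    (fun f => (BoundedContinuousFunction.norm_le (norm_nonneg _)).2 (hbound f))
    (fun f => by
      ext a
      have h := (lp.hasSum_single (p := 1) (by simp) a).mapL f
      refine (h.unique ?_).symm
      have h2 := ((summable_norm_mul_bounded a _).of_norm :
        Summable fun i => a i * (BoundedContinuousFunction.ofNormedAddCommGroupDiscrete
          (fun i => f (lp.single 1 i 1)) ‖f‖ (hbound f)) i).hasSum
      refine Eq.mp ?_ h2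
      congr 1
      funext i
      change a i * f (lp.single 1 i 1) = f (lp.single 1 i (a i))
      rw [← smul_eq_mul, ← map_smul, ← lp.single_smul, smul_eq_mul, mul_one])
    (fun b => by
      ext i
      change ∑' k, (lp.single (E := fun _ : ℕ => 𝕜) 1 i 1 : SeqL1 𝕜) k * b k = b i
      rw [tsum_eq_single i fun k hk => by rw [lp.single_apply_ne _ _ _ hk, zero_mul],
        lp.single_apply_self, one_mul])

/-- The unit vectors of `c₀`. -/
noncomputable def c0Single (𝕜 : Type*) [RCLike 𝕜] (i : ℕ) : SeqC0 𝕜 where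
  toFun := Pi.single i 1
  continuous_toFun := continuous_of_discreteTopology
  zero_at_infty' := by
    rw [Filter.cocompact_eq_cofinite]
    refine tendsto_const_nhds.congr' ?_
    filter_upwards [(Set.finite_singleton i).compl_mem_cofinite] with k hk
    have : k ≠ i := hk
    simp [this]

theorem c0Single_apply (i k : ℕ) : c0Single 𝕜 i k = if k = i then 1 else 0 := by
  change Pi.single (M := fun _ : ℕ => 𝕜) i 1 k = _
  rw [Pi.single_apply]

theorem norm_c0_le {x : SeqC0 𝕜} {C : ℝ} (hC : 0 ≤ C) (h : ∀ i, ‖x i‖ ≤ C) : ‖x‖ ≤ C := by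
  rw [← ZeroAtInftyContinuousMap.norm_toBCF_eq_norm]
  exact (BoundedContinuousFunction.norm_le hC).2 h

theorem sum_smul_c0Single_apply (s : Finset ℕ) (y : ℕ → 𝕜) (k : ℕ) :
    (∑ i ∈ s, y i • c0Single 𝕜 i) k = if k ∈ s then y k else 0 := by
  induction s using Finset.induction_on with
  | empty => simp
  | insert i s hi ih =>
    rw [Finset.sum_insert hi, ZeroAtInftyContinuousMap.add_apply, ih,
      ZeroAtInftyContinuousMap.smul_apply, c0Single_apply]
    by_cases hk : k = i
    · subst hk; simp [hi]
    · simp [hk]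

theorem hasSum_c0Single (x : SeqC0 𝕜) : HasSum (fun i => x i • c0Single 𝕜 i) x := by
  rw [HasSum, Metric.tendsto_nhds]
  intro ε hε
  have h0 : Filter.Tendsto x Filter.cofinite (nhds 0) := by
    rw [← Filter.cocompact_eq_cofinite]; exact x.zero_at_infty'
  have h1 := Metric.tendsto_nhds.1 h0 (ε / 2) (by positivity)
  rw [Filter.eventually_cofinite] at h1
  filter_upwards [Filter.eventually_ge_atTop h1.toFinset] with s hs
  rw [dist_eq_norm]
  refine (norm_c0_le (by positivity : 0 ≤ ε / 2) fun k => ?_).trans_lt (by linarith)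
  rw [ZeroAtInftyContinuousMap.sub_apply, sum_smul_c0Single_apply]
  by_cases hk : k ∈ s
  · simp [hk]; positivity
  · simp only [hk, if_false, zero_sub, norm_neg]
    by_contra hcon
    refine hk (hs (h1.mem_toFinset.2 ?_))
    change ¬ dist (x k) 0 < ε / 2
    rw [dist_zero_right]
    linarith

/-- The inclusion of `c₀` into the bounded sequences. -/
noncomputable def c0ToBounded (𝕜 : Type*) [RCLike 𝕜] : SeqC0 𝕜 →L[𝕜] (ℕ →ᵇ 𝕜) :=
  LinearMap.mkContinuous
    { toFun := fun x => x.toBCF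
      map_add' := fun _ _ => rfl
      map_smul' := fun _ _ => rfl } 1 (fun x => by rw [one_mul]; exact le_rfl)

theorem sum_norm_apply_c0Single_le (f : StrongDual 𝕜 (SeqC0 𝕜)) (s : Finset ℕ) :
    ∑ i ∈ s, ‖f (c0Single 𝕜 i)‖ ≤ ‖f‖ := by
  have h := sum_norm_le_of_forall_unit (𝕜 := 𝕜) (V := 𝕜) s
    (fun i => (ContinuousLinearMap.id 𝕜 𝕜).smulRight (f (c0Single 𝕜 i))) ‖f‖ fun y hy => by
      have h1 : ∑ i ∈ s, (ContinuousLinearMap.id 𝕜 𝕜).smulRight (f (c0Single 𝕜 i)) (y i) =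
          f (∑ i ∈ s, y i • c0Single 𝕜 i) := by simp
      rw [h1]
      refine (f.le_opNorm _).trans (mul_le_of_le_one_right (norm_nonneg _)
        (norm_c0_le zero_le_one fun k => ?_))
      rw [sum_smul_c0Single_apply]
      split_ifs
      · exact hy k
      · simp
  refine le_trans (Finset.sum_le_sum fun i _ => ?_) h
  rw [ContinuousLinearMap.norm_smulRight_apply, ContinuousLinearMap.norm_id, one_mul]

/-- The dual of `c₀` is `ℓ₁`. -/
noncomputable def dualSeqC0 (𝕜 : Type*) [RCLike 𝕜] : StrongDual 𝕜 (SeqC0 𝕜) ≃ₗᵢ[𝕜] SeqL1 𝕜 :=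
  have hmem : ∀ f : StrongDual 𝕜 (SeqC0 𝕜), Memℓp (fun i => f (c0Single 𝕜 i)) 1 := fun f =>
    memℓp_gen' (C := ‖f‖) fun s => by simpa using sum_norm_apply_c0Single_le f s
  isometryOfContractions
    { toFun := fun f => (⟨fun i => f (c0Single 𝕜 i), hmem f⟩ : SeqL1 𝕜)
      map_add' := fun f g => rfl
      map_smul' := fun c f => rfl }
    { toFun := fun a => seqPairing 𝕜 a ∘L c0ToBounded 𝕜
      map_add' := fun a b => by rw [map_add, ContinuousLinearMap.add_comp]
      map_smul' := fun c a => by rw [map_smul, ContinuousLinearMap.smul_comp]; rfl }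
    (fun f => lp.norm_le_of_forall_sum_le (by simp) (norm_nonneg _) fun s => by
      simp only [ENNReal.toReal_one, Real.rpow_one]
      exact sum_norm_apply_c0Single_le f s)
    (fun a => ContinuousLinearMap.opNorm_le_bound _ (norm_nonneg _) fun x =>
      norm_seqPairing_apply_le a _)
    (fun a => by
      apply lp.ext
      funext i
      change ∑' k, a k * c0Single 𝕜 i k = a i
      rw [tsum_eq_single i fun k hk => by rw [c0Single_apply, if_neg hk, mul_zero],
        c0Single_apply, if_pos rfl, mul_one])
    (fun f => by
      ext x
      have h := (hasSum_c0Single x).mapL f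
      refine Eq.trans ?_ h.tsum_eq
      refine tsum_congr fun i => ?_
      rw [map_smul, smul_eq_mul, mul_comm]
      rfl)

theorem isIsometricPredualL1_seqC0 (𝕜 : Type*) [RCLike 𝕜] : IsIsometricPredualL1 𝕜 (SeqC0 𝕜) :=
  ⟨dualSeqC0 𝕜⟩

end SequenceSpaces

section BidualOfBoundedSequences

open scoped BoundedContinuousFunction

variable {𝕜 : Type*} [RCLike 𝕜]

theorem exists_unit_lt_apply_of_lt_opNorm {V W : Type*} [NormedAddCommGroup V] [NormedSpace 𝕜 V]
    [NormedAddCommGroup W] [NormedSpace 𝕜 W] [Nontrivial V] (T : V →L[𝕜] W) {r : ℝ}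
    (hr : r < ‖T‖) : ∃ v : V, ‖v‖ = 1 ∧ r < ‖T v‖ := by
  by_contra! hcon
  by_cases h0 : 0 ≤ r
  · exact absurd (ContinuousLinearMap.opNorm_le_of_unit_norm h0 hcon) (not_le.2 hr)
  · obtain ⟨u, -, -, -, hu, -⟩ := exists_convex_combination_unit (𝕜 := 𝕜) (0 : V) (by simp)
    exact h0 ((norm_nonneg _).trans (hcon u hu))

/-- Goldstine's theorem. -/
theorem exists_unitBall_approx_bidual {V : Type*} [NormedAddCommGroup V] [NormedSpace 𝕜 V]
    (y : StrongDual 𝕜 (StrongDual 𝕜 V)) (hy : ‖y‖ ≤ 1) (F : Finset (StrongDual 𝕜 V)) (δ : ℝ)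
    (hδ : 0 < δ) : ∃ b : V, ‖b‖ ≤ 1 ∧ ∀ ν ∈ F, ‖ν b - y ν‖ ≤ δ := by
  classical
  let A : Set (F → 𝕜) := {x | ∃ b : V, ‖b‖ ≤ 1 ∧ ∀ ν : F, x ν = (ν : StrongDual 𝕜 V) b}
  set z : F → 𝕜 := fun ν => y ν
  by_cases hz : z ∈ closure A
  · obtain ⟨x, ⟨b, hb, hx⟩, hd⟩ := Metric.mem_closure_iff.1 hz δ hδ
    refine ⟨b, hb, fun ν hν => ?_⟩
    have := (dist_le_pi_dist z x ⟨ν, hν⟩).trans hd.le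
    rwa [hx, dist_comm, dist_eq_norm] at this
  exfalso
  have hA : Convex ℝ A := by
    rintro x ⟨b, hb, hx⟩ x' ⟨b', hb', hx'⟩ s t hs ht hst
    refine ⟨(s : 𝕜) • b + (t : 𝕜) • b', ?_, fun ν => ?_⟩
    · calc ‖(s : 𝕜) • b + (t : 𝕜) • b'‖ ≤ s * ‖b‖ + t * ‖b'‖ := by
            refine (norm_add_le _ _).trans ?_
            rw [norm_smul, norm_smul, RCLike.norm_ofReal, RCLike.norm_ofReal, abs_of_nonneg hs,
              abs_of_nonneg ht]
        _ ≤ s * 1 + t * 1 := by gcongr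
        _ = 1 := by rw [mul_one, mul_one, hst]
    · simp [hx, hx', RCLike.real_smul_eq_coe_mul]
  obtain ⟨g, u, hgA, hgz⟩ := RCLike.geometric_hahn_banach_closed_point (𝕜 := 𝕜) hA.closure
    isClosed_closure hz
  have hg : ∀ x : F → 𝕜, g x = ∑ ν, x ν * g (Pi.single ν 1) := by
    intro x
    conv_lhs => rw [← Finset.univ_sum_single x]
    rw [map_sum]
    refine Finset.sum_congr rfl fun ν _ => ?_
    rw [← smul_eq_mul, ← map_smul, ← Pi.single_smul, smul_eq_mul, mul_one]
  let Ν : StrongDual 𝕜 V := ∑ ν : F, g (Pi.single ν 1) • (ν : StrongDual 𝕜 V)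
  have hΝ : ‖Ν‖ ≤ u := by
    have hu0 : 0 ≤ u := by
      have := hgA 0 (subset_closure ⟨0, by simp, by simp⟩)
      simpa using this.le
    refine ContinuousLinearMap.opNorm_le_of_unit_norm hu0 fun b hb => ?_
    obtain ⟨θ, hθ, hθc⟩ := exists_norm_one_mul_eq_norm (Ν b)
    have h1 := hgA (fun ν => (ν : StrongDual 𝕜 V) (θ • b))
      (subset_closure ⟨θ • b, by rw [norm_smul, hθ, hb, one_mul], fun ν => rfl⟩)
    have h2 : g (fun ν : F => (ν : StrongDual 𝕜 V) (θ • b)) = θ * Ν b := by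
      rw [hg, ← smul_eq_mul, ← map_smul]
      simp [Ν, sum_apply, mul_comm, Finset.mul_sum]
      simp only [mul_assoc]
    rw [h2, hθc, RCLike.ofReal_re] at h1
    exact h1.le
  have h3 : g z = y Ν := by
    rw [hg]
    simp [Ν, z, map_sum, mul_comm]
  have h4 : ‖g z‖ ≤ u := by
    rw [h3]
    exact (y.le_opNorm Ν).trans ((mul_le_of_le_one_left (norm_nonneg _) hy).trans hΝ)
  exact absurd ((RCLike.re_le_norm (g z)).trans h4) (not_le.2 hgz)

/-- Bounded families of functionals converge pointwise along ultrafilters. -/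
theorem exists_tendsto_dual_of_ultrafilter {ι M : Type*} [NormedAddCommGroup M] [NormedSpace 𝕜 M]
    (U : Ultrafilter ι) (F : ι → StrongDual 𝕜 M) (C : ℝ) (hF : ∀ i, ‖F i‖ ≤ C) :
    ∃ y : StrongDual 𝕜 M, ‖y‖ ≤ C ∧ ∀ m, Filter.Tendsto (fun i => F i m) U (nhds (y m)) := by
  have hK := WeakDual.isCompact_closedBall (𝕜 := 𝕜) (0 : StrongDual 𝕜 M) C
  have hmem : ∀ᶠ i in (U : Filter ι), StrongDual.toWeakDual (F i) ∈
      (WeakDual.toStrongDual ⁻¹' Metric.closedBall (0 : StrongDual 𝕜 M) C) :=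
    Filter.Eventually.of_forall fun i => by
      have := hF i
      simpa using this
  obtain ⟨y, hy, hlim⟩ := hK.ultrafilter_le_nhds (U.map fun i => StrongDual.toWeakDual (F i))
    (Filter.le_principal_iff.2 hmem)
  refine ⟨WeakDual.toStrongDual y, by simpa using hy, fun m => ?_⟩
  have h1 : Filter.Tendsto (fun i => StrongDual.toWeakDual (F i)) U (nhds y) := hlim
  exact ((WeakDual.eval_continuous m).tendsto y).comp h1

/-- The functional `b ↦ μ (a b)`. -/
noncomputable def mulDual (μ : StrongDual 𝕜 (ℕ →ᵇ 𝕜)) (a : ℕ →ᵇ 𝕜) : StrongDual 𝕜 (ℕ →ᵇ 𝕜) :=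
  μ ∘L ContinuousLinearMap.mul 𝕜 (ℕ →ᵇ 𝕜) a

theorem mulDual_apply (μ : StrongDual 𝕜 (ℕ →ᵇ 𝕜)) (a b : ℕ →ᵇ 𝕜) :
    mulDual μ a b = μ (a * b) := rfl

theorem mulDual_add (μ : StrongDual 𝕜 (ℕ →ᵇ 𝕜)) (a b : ℕ →ᵇ 𝕜) :
    mulDual μ (a + b) = mulDual μ a + mulDual μ b := by
  ext c; simp [mulDual_apply, add_mul]

theorem mulDual_smul (μ : StrongDual 𝕜 (ℕ →ᵇ 𝕜)) (c : 𝕜) (a : ℕ →ᵇ 𝕜) :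
    mulDual μ (c • a) = c • mulDual μ a := by
  ext b; simp [mulDual_apply]

theorem mulDual_sum {ι : Type*} (s : Finset ι) (μ : StrongDual 𝕜 (ℕ →ᵇ 𝕜)) (a : ι → ℕ →ᵇ 𝕜) :
    mulDual μ (∑ i ∈ s, a i) = ∑ i ∈ s, mulDual μ (a i) := by
  ext b; simp [mulDual_apply, Finset.sum_mul]

theorem mulDual_one (μ : StrongDual 𝕜 (ℕ →ᵇ 𝕜)) : mulDual μ 1 = μ := by
  ext b; simp [mulDual_apply]

/-- A bounded sequence, as a bounded continuous function. -/
noncomputable def boundedSeq (f : ℕ → 𝕜) (C : ℝ) (hf : ∀ n, ‖f n‖ ≤ C) : ℕ →ᵇ 𝕜 :=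
  BoundedContinuousFunction.ofNormedAddCommGroupDiscrete f C hf

theorem boundedSeq_apply (f : ℕ → 𝕜) (C : ℝ) (hf : ∀ n, ‖f n‖ ≤ C) (n : ℕ) :
    boundedSeq f C hf n = f n := rfl

theorem norm_boundedSeq_le (f : ℕ → 𝕜) (C : ℝ) (hf : ∀ n, ‖f n‖ ≤ C) : ‖boundedSeq f C hf‖ ≤ C :=
  (BoundedContinuousFunction.norm_le ((norm_nonneg _).trans (hf 0))).2 hf

theorem sum_norm_mulDual_le {ι : Type*} (s : Finset ι) (μ : StrongDual 𝕜 (ℕ →ᵇ 𝕜))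
    (a : ι → ℕ →ᵇ 𝕜) (c : ℕ →ᵇ 𝕜) (h : ∀ n, ∑ i ∈ s, ‖a i n‖ ≤ ‖c n‖) :
    ∑ i ∈ s, ‖mulDual μ (a i)‖ ≤ ‖mulDual μ c‖ := by
  refine sum_norm_le_of_forall_unit s _ _ fun b hb => ?_
  have hle : ∀ n, ‖∑ i ∈ s, a i n * b i n‖ ≤ ‖c n‖ := by
    intro n
    refine (norm_sum_le_of_le _ fun i _ => ?_).trans (h n)
    rw [norm_mul]
    exact mul_le_of_le_one_right (norm_nonneg _) (((b i).norm_coe_le_norm n).trans (hb i))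
  let d : ℕ →ᵇ 𝕜 := boundedSeq (fun n => (∑ i ∈ s, a i n * b i n) / c n) 1 fun n => by
    rw [norm_div]
    exact div_le_one_of_le₀ (hle n) (norm_nonneg _)
  have hd : ∑ i ∈ s, a i * b i = c * d := by
    ext n
    rw [BoundedContinuousFunction.mul_apply, BoundedContinuousFunction.coe_sum, Finset.sum_apply]
    change ∑ i ∈ s, a i n * b i n = c n * ((∑ i ∈ s, a i n * b i n) / c n)
    by_cases hc : c n = 0
    · have := hle n
      rw [hc, norm_zero] at this
      rw [norm_le_zero_iff.1 this, hc]
      simp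
    · rw [mul_div_cancel₀ _ hc]
  calc ‖∑ i ∈ s, mulDual μ (a i) (b i)‖ = ‖mulDual μ c d‖ := by
        simp only [mulDual_apply]
        rw [← map_sum, hd]
    _ ≤ ‖mulDual μ c‖ * 1 := (ContinuousLinearMap.le_opNorm _ _).trans
        (by gcongr; exact norm_boundedSeq_le _ _ _)
    _ = ‖mulDual μ c‖ := mul_one _

theorem norm_mulDual_mono (μ : StrongDual 𝕜 (ℕ →ᵇ 𝕜)) (a c : ℕ →ᵇ 𝕜) (h : ∀ n, ‖a n‖ ≤ ‖c n‖) :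
    ‖mulDual μ a‖ ≤ ‖mulDual μ c‖ := by
  simpa using sum_norm_mulDual_le {()} μ (fun _ => a) c (by simpa using h)

theorem norm_star_mul_self_apply (a : ℕ →ᵇ 𝕜) (n : ℕ) : ‖(star a * a) n‖ = ‖a n‖ ^ 2 := by
  simp [sq]

theorem star_mul_self_apply (a : ℕ →ᵇ 𝕜) (n : ℕ) : (star a * a) n = ((‖a n‖ ^ 2 : ℝ) : 𝕜) := by
  simp [RCLike.conj_mul]

/-- The parallelogram inequality for `a ↦ ‖|a|² μ‖`. -/
theorem norm_mulDual_parallelogram (μ : StrongDual 𝕜 (ℕ →ᵇ 𝕜)) (a b : ℕ →ᵇ 𝕜) :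
    ‖mulDual μ (star (a + b) * (a + b))‖ + ‖mulDual μ (star (a - b) * (a - b))‖ ≤
      2 * ‖mulDual μ (star a * a)‖ + 2 * ‖mulDual μ (star b * b)‖ := by
  have h := sum_norm_mulDual_le Finset.univ μ
    ![star (a + b) * (a + b), star (a - b) * (a - b)]
    ((2 : 𝕜) • (star a * a) + (2 : 𝕜) • (star b * b)) fun n => by
      rw [Fin.sum_univ_two]
      simp only [Matrix.cons_val_zero, Matrix.cons_val_one, norm_star_mul_self_apply]
      change ‖a n + b n‖ ^ 2 + ‖a n - b n‖ ^ 2 ≤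
        ‖(2 : 𝕜) • (star a * a) n + (2 : 𝕜) • (star b * b) n‖
      rw [star_mul_self_apply, star_mul_self_apply]
      have h1 : (2 : 𝕜) • (((‖a n‖ ^ 2 : ℝ) : 𝕜)) + (2 : 𝕜) • (((‖b n‖ ^ 2 : ℝ) : 𝕜)) =
          ((2 * ‖a n‖ ^ 2 + 2 * ‖b n‖ ^ 2 : ℝ) : 𝕜) := by push_cast; simp
      rw [h1, RCLike.norm_ofReal, abs_of_nonneg (by positivity)]
      have := parallelogram_law_with_norm 𝕜 (a n) (b n)
      nlinarith
  rw [Fin.sum_univ_two] at h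
  simp only [Matrix.cons_val_zero, Matrix.cons_val_one] at h
  refine h.trans ?_
  rw [mulDual_add, mulDual_smul, mulDual_smul]
  refine (norm_add_le _ _).trans ?_
  rw [norm_smul, norm_smul, RCLike.norm_two]

theorem norm_mulDual_le_of_sq (μ : StrongDual 𝕜 (ℕ →ᵇ 𝕜)) (hμ : ‖μ‖ ≤ 1) (a : ℕ →ᵇ 𝕜) (η : ℝ)
    (hη : 0 < η) (h : ‖mulDual μ (star a * a)‖ ≤ η ^ 2) : ‖mulDual μ a‖ ≤ η := by
  have h1 : ‖mulDual μ a‖ ≤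
      ‖mulDual μ (((1 / (2 * η) : ℝ) : 𝕜) • (star a * a) + ((η / 2 : ℝ) : 𝕜) • (1 : ℕ →ᵇ 𝕜))‖ := by
    refine norm_mulDual_mono _ _ _ fun n => ?_
    rw [BoundedContinuousFunction.add_apply, BoundedContinuousFunction.smul_apply,
      BoundedContinuousFunction.smul_apply, star_mul_self_apply]
    have h2 : ((1 / (2 * η) : ℝ) : 𝕜) • (((‖a n‖ ^ 2 : ℝ)) : 𝕜) +
        ((η / 2 : ℝ) : 𝕜) • ((1 : ℕ →ᵇ 𝕜) n) = ((1 / (2 * η) * ‖a n‖ ^ 2 + η / 2 : ℝ) : 𝕜) := by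
      push_cast; simp
    rw [h2, RCLike.norm_ofReal, abs_of_nonneg (by positivity)]
    have h3 : 1 / (2 * η) * ‖a n‖ ^ 2 + η / 2 - ‖a n‖ = (‖a n‖ - η) ^ 2 / (2 * η) := by
      field_simp; ring
    have : 0 ≤ (‖a n‖ - η) ^ 2 / (2 * η) := by positivity
    linarith
  refine h1.trans ?_
  rw [mulDual_add, mulDual_smul, mulDual_smul, mulDual_one]
  refine (norm_add_le _ _).trans ?_
  rw [norm_smul, norm_smul, RCLike.norm_ofReal, RCLike.norm_ofReal, abs_of_pos (by positivity),
    abs_of_pos (by positivity)]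
  calc 1 / (2 * η) * ‖mulDual μ (star a * a)‖ + η / 2 * ‖μ‖
      ≤ 1 / (2 * η) * η ^ 2 + η / 2 * 1 := by gcongr
    _ = η := by field_simp; ring

end BidualOfBoundedSequences

section BidualOfBoundedSequences

open scoped BoundedContinuousFunction

variable {𝕜 : Type*} [RCLike 𝕜]

/-- Every functional on bounded sequences is almost normed by a unimodular sequence. -/
theorem exists_unimodular_seq (μ : StrongDual 𝕜 (ℕ →ᵇ 𝕜)) (ε : ℝ) (hε : 0 < ε) :
    ∃ s : ℕ →ᵇ 𝕜, (∀ n, ‖s n‖ = 1) ∧ ‖μ‖ - ε ≤ RCLike.re (μ s) := by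
  obtain ⟨b, hb, hμb⟩ := μ.exists_lt_apply_of_lt_opNorm (show ‖μ‖ - ε / 2 < ‖μ‖ by linarith)
  obtain ⟨θ, hθ, hθc⟩ := exists_norm_one_mul_eq_norm (μ b)
  let r : ℕ →ᵇ 𝕜 := θ • b
  have hr : ‖r‖ ≤ 1 := by rw [norm_smul, hθ, one_mul]; exact hb.le
  have hrn : ∀ n, ‖r n‖ ≤ 1 := fun n => (r.norm_coe_le_norm n).trans hr
  have hμr : μ r = (‖μ b‖ : 𝕜) := by rw [map_smul, smul_eq_mul, hθc]
  have hex : ∀ n, ∃ c : 𝕜, ‖c‖ = 1 ∧ ‖c - r n‖ = 1 - ‖r n‖ := by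
    intro n
    obtain ⟨ϑ, hϑ, hϑc⟩ := exists_norm_one_mul_eq_norm (r n)
    have h0 : ϑ ≠ 0 := by rw [← norm_ne_zero_iff, hϑ]; exact one_ne_zero
    refine ⟨ϑ⁻¹, by rw [norm_inv, hϑ, inv_one], ?_⟩
    have h1 : ϑ⁻¹ - r n = ϑ⁻¹ * ((1 - ‖r n‖ : ℝ) : 𝕜) := by
      have h2 : ((1 - ‖r n‖ : ℝ) : 𝕜) = 1 - ϑ * r n := by
        rw [hϑc, RCLike.ofReal_sub, RCLike.ofReal_one]
      rw [h2, mul_sub, mul_one, inv_mul_cancel_left₀ h0]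
    rw [h1, norm_mul, norm_inv, hϑ, inv_one, one_mul, RCLike.norm_ofReal,
      abs_of_nonneg (by linarith [hrn n])]
  choose c hc hcr using hex
  let s : ℕ →ᵇ 𝕜 := boundedSeq c 1 fun n => (hc n).le
  have hsum := sum_norm_mulDual_le Finset.univ μ ![s - r, r] 1 fun n => by
    rw [Fin.sum_univ_two]
    change ‖c n - r n‖ + ‖r n‖ ≤ ‖(1 : 𝕜)‖
    rw [hcr, norm_one]
    linarith
  rw [Fin.sum_univ_two, mulDual_one] at hsum
  simp only [Matrix.cons_val_zero, Matrix.cons_val_one] at hsum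
  have h2 : ‖μ b‖ ≤ ‖mulDual μ r‖ := by
    have := (mulDual μ r).le_opNorm 1
    rw [mulDual_apply, mul_one, hμr, norm_one, mul_one, RCLike.norm_ofReal, abs_norm] at this
    exact this
  have h3 : ‖μ (s - r)‖ ≤ ε / 2 := by
    have := (mulDual μ (s - r)).le_opNorm 1
    rw [mulDual_apply, mul_one, norm_one, mul_one] at this
    linarith
  refine ⟨s, hc, ?_⟩
  have h4 : RCLike.re (μ s) = RCLike.re (μ r) + RCLike.re (μ (s - r)) := by
    rw [← map_add, ← map_add]; congr 2; abel
  have h5 := (abs_le.1 ((RCLike.abs_re_le_norm (μ (s - r))).trans h3)).1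
  rw [h4, hμr, RCLike.ofReal_re]
  linarith

/-- A point of the bidual ball is a weak-star limit of a net in the ball which is almost constant
with respect to a given functional. -/
theorem exists_concentrated_net (μ : StrongDual 𝕜 (ℕ →ᵇ 𝕜)) (hμ : ‖μ‖ ≤ 1)
    (y : StrongDual 𝕜 (StrongDual 𝕜 (ℕ →ᵇ 𝕜))) (hy : ‖y‖ ≤ 1) (η : ℝ) (hη : 0 < η) :
    ∃ b : Finset (StrongDual 𝕜 (ℕ →ᵇ 𝕜)) × ℕ → ℕ →ᵇ 𝕜, (∀ i, ‖b i‖ ≤ 1) ∧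
      (∀ ν, Filter.Tendsto (fun i => ν (b i)) Filter.atTop (nhds (y ν))) ∧
      ∀ i j, ‖mulDual μ (b i - b j)‖ ≤ η := by
  classical
  let q : (ℕ →ᵇ 𝕜) → ℝ := fun a => ‖mulDual μ (star a * a)‖
  let V : Finset (StrongDual 𝕜 (ℕ →ᵇ 𝕜)) × ℕ → Set (ℕ →ᵇ 𝕜) := fun i =>
    {b | ‖b‖ ≤ 1 ∧ ∀ ν ∈ i.1, ‖ν b - y ν‖ ≤ 1 / ((i.2 : ℝ) + 1)}
  have hVne : ∀ i, (V i).Nonempty := fun i =>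
    exists_unitBall_approx_bidual y hy i.1 (1 / ((i.2 : ℝ) + 1)) (by positivity)
  have hVanti : ∀ i j, i ≤ j → V j ⊆ V i := by
    rintro i j ⟨h1, h2⟩ b ⟨hb, hν⟩
    refine ⟨hb, fun ν hi => (hν ν (h1 hi)).trans ?_⟩
    have : (i.2 : ℝ) ≤ j.2 := by exact_mod_cast h2
    gcongr
  let R : Set ℝ := {r | ∀ i, ∃ b ∈ V i, q b ≤ r}
  have hR1 : (1 : ℝ) ∈ R := by
    intro i
    obtain ⟨b, hb⟩ := hVne i
    refine ⟨b, hb, ?_⟩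
    refine (norm_mulDual_mono μ _ 1 fun n => ?_).trans (by rw [mulDual_one]; exact hμ)
    rw [norm_star_mul_self_apply]
    change _ ≤ ‖(1 : 𝕜)‖
    rw [norm_one]
    exact pow_le_one₀ (norm_nonneg _) ((b.norm_coe_le_norm n).trans hb.1)
  have hRb : BddBelow R := ⟨0, fun r hr => by
    obtain ⟨b, -, hb⟩ := hr (∅, 0)
    exact (norm_nonneg _).trans hb⟩
  set δ := η ^ 2 / 8 with hδ
  have hδ0 : 0 < δ := by positivity
  obtain ⟨r, hrR, hr⟩ := exists_lt_of_csInf_lt ⟨1, hR1⟩ (show sInf R < sInf R + δ by linarith)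
  have hnot : sInf R - δ ∉ R := fun h => by linarith [csInf_le hRb h]
  have hnot' : ∃ i₀, ∀ b ∈ V i₀, sInf R - δ < q b := by
    by_contra! hcon
    exact hnot hcon
  obtain ⟨i₀, hi₀⟩ := hnot'
  choose b hbV hbq using fun i => hrR (i ⊔ i₀)
  refine ⟨b, fun i => (hbV i).1, fun ν => ?_, fun i j => ?_⟩
  · rw [Metric.tendsto_nhds]
    intro ε hε
    obtain ⟨n, hn⟩ := exists_nat_one_div_lt hε
    filter_upwards [Filter.eventually_ge_atTop (({ν}, n) :
      Finset (StrongDual 𝕜 (ℕ →ᵇ 𝕜)) × ℕ)] with i hi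
    rw [dist_eq_norm]
    exact ((hVanti _ _ (hi.trans le_sup_left) (hbV i)).2 ν (by simp)).trans_lt hn
  · have hi := hVanti _ _ le_sup_right (hbV i)
    have hj := hVanti _ _ le_sup_right (hbV j)
    have hmid : ((1 / 2 : ℝ) : 𝕜) • (b i + b j) ∈ V i₀ := by
      have hhalf : ‖((1 / 2 : ℝ) : 𝕜)‖ = 1 / 2 := by
        rw [RCLike.norm_ofReal, abs_of_pos (by norm_num)]
      refine ⟨?_, fun ν hν => ?_⟩
      · rw [norm_smul, hhalf]
        linarith [norm_add_le (b i) (b j), hi.1, hj.1]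
      · have h1 : ν (((1 / 2 : ℝ) : 𝕜) • (b i + b j)) - y ν =
            ((1 / 2 : ℝ) : 𝕜) * ((ν (b i) - y ν) + (ν (b j) - y ν)) := by
          rw [map_smul, map_add, smul_eq_mul]
          push_cast
          ring
        rw [h1, norm_mul, hhalf]
        linarith [norm_add_le (ν (b i) - y ν) (ν (b j) - y ν), hi.2 ν hν, hj.2 ν hν]
    have h1 := hi₀ _ hmid
    have h2 : q (((1 / 2 : ℝ) : 𝕜) • (b i + b j)) =
        1 / 4 * ‖mulDual μ (star (b i + b j) * (b i + b j))‖ := by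
      have : star (((1 / 2 : ℝ) : 𝕜) • (b i + b j)) * (((1 / 2 : ℝ) : 𝕜) • (b i + b j)) =
          ((1 / 4 : ℝ) : 𝕜) • (star (b i + b j) * (b i + b j)) := by
        rw [star_smul, smul_mul_smul_comm]
        congr 1
        simp only [RCLike.star_def, RCLike.conj_ofReal]
        push_cast
        norm_num
      simp only [q]
      rw [this, mulDual_smul, norm_smul, RCLike.norm_ofReal, abs_of_pos (by norm_num)]
    have h3 := norm_mulDual_parallelogram μ (b i) (b j)
    refine norm_mulDual_le_of_sq μ hμ _ η hη ?_
    have h4 : ‖mulDual μ (star (b i) * b i)‖ ≤ r := hbq i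
    have h5 : ‖mulDual μ (star (b j) * b j)‖ ≤ r := hbq j
    rw [h2] at h1
    have h6 : η ^ 2 = 8 * δ := by rw [hδ]; ring
    linarith

/-- A Lipschitz partition of unity of the unit disc into small pieces. -/
theorem exists_partition_unitDisc (𝕜 : Type*) [RCLike 𝕜] (ε : ℝ) (hε : 0 < ε) :
    ∃ (t : Finset 𝕜) (φ : 𝕜 → 𝕜 → ℝ) (K : ℝ), 0 < K ∧ (∀ c ∈ t, ‖c‖ ≤ 1) ∧
      (∀ c z, 0 ≤ φ c z) ∧ (∀ c z, φ c z ≠ 0 → ‖z - c‖ < ε) ∧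
      (∀ z, ‖z‖ ≤ 1 → ∑ c ∈ t, φ c z = 1) ∧
      ∀ c ∈ t, ∀ z w, ‖z‖ ≤ 1 → ‖w‖ ≤ 1 → |φ c z - φ c w| ≤ K * ‖z - w‖ := by
  classical
  obtain ⟨t', ht', htf, htc⟩ := (isCompact_closedBall (0 : 𝕜) 1).finite_cover_balls
    (show 0 < ε / 2 by positivity)
  set t := htf.toFinset
  let f : 𝕜 → 𝕜 → ℝ := fun c z => max 0 (ε - ‖z - c‖)
  let F : 𝕜 → ℝ := fun z => ∑ c ∈ t, f c z
  have hf0 : ∀ c z, 0 ≤ f c z := fun c z => le_max_left _ _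
  have hfF : ∀ c ∈ t, ∀ z, f c z ≤ F z := fun c hc z =>
    Finset.single_le_sum (f := fun c => f c z) (fun c _ => hf0 c z) hc
  have hF : ∀ z, ‖z‖ ≤ 1 → ε / 2 ≤ F z := by
    intro z hz
    obtain ⟨c, hc, hd⟩ := Set.mem_iUnion₂.1 (htc (by simpa using hz : z ∈ _))
    rw [Metric.mem_ball, dist_eq_norm] at hd
    refine le_trans ?_ (hfF c (htf.mem_toFinset.2 hc) z)
    exact le_trans (by linarith) (le_max_right _ _)
  have hfl : ∀ c z w, |f c z - f c w| ≤ ‖z - w‖ := by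
    intro c z w
    refine (abs_max_sub_max_le_max 0 (ε - ‖z - c‖) 0 (ε - ‖w - c‖)).trans ?_
    rw [sub_self, abs_zero, max_eq_right (abs_nonneg _)]
    have h1 := abs_norm_sub_norm_le (w - c) (z - c)
    rw [show (w - c) - (z - c) = w - z by abel, norm_sub_rev w z] at h1
    rwa [show ε - ‖z - c‖ - (ε - ‖w - c‖) = ‖w - c‖ - ‖z - c‖ by ring]
  have hFl : ∀ z w, |F z - F w| ≤ t.card * ‖z - w‖ := by
    intro z w
    rw [← Finset.sum_sub_distrib, ← nsmul_eq_mul]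
    exact (Finset.abs_sum_le_sum_abs _ _).trans
      (Finset.sum_le_card_nsmul _ _ _ fun c _ => hfl c z w)
  refine ⟨t, fun c z => f c z / F z, (1 + t.card) * (2 / ε), by positivity, ?_, ?_, ?_, ?_, ?_⟩
  · intro c hc
    simpa using ht' (htf.mem_toFinset.1 hc)
  · exact fun c z => div_nonneg (hf0 c z) (Finset.sum_nonneg fun c _ => hf0 c z)
  · intro c z h
    by_contra! hcon
    exact h (by simp [f, max_eq_left (sub_nonpos.2 hcon)])
  · intro z hz
    rw [← Finset.sum_div]
    exact div_self (by linarith [hF z hz])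
  · intro c hc z w hz hw
    have hFz : 0 < F z := by linarith [hF z hz]
    have hFw : 0 < F w := by linarith [hF w hw]
    have h1 : f c z / F z - f c w / F w =
        ((f c z - f c w) + f c w / F w * (F w - F z)) / F z := by
      field_simp; ring
    have h2 : f c w / F w ≤ 1 := div_le_one_of_le₀ (hfF c hc w) hFw.le
    have h3 : 0 ≤ f c w / F w := div_nonneg (hf0 c w) hFw.le
    have h4 : |f c w / F w * (F w - F z)| ≤ t.card * ‖z - w‖ := by
      rw [abs_mul, abs_of_nonneg h3, abs_sub_comm]
      exact (mul_le_of_le_one_left (abs_nonneg _) h2).trans (hFl z w)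
    rw [h1, abs_div, abs_of_pos hFz, div_le_iff₀ hFz]
    refine (abs_add_le _ _).trans ((add_le_add (hfl c z w) h4).trans ?_)
    have h5 : 1 ≤ 2 / ε * F z := by
      rw [div_mul_eq_mul_div, le_div_iff₀ hε]; linarith [hF z hz]
    calc ‖z - w‖ + t.card * ‖z - w‖ = (1 + t.card) * ‖z - w‖ * 1 := by ring
      _ ≤ (1 + t.card) * ‖z - w‖ * (2 / ε * F z) := by gcongr
      _ = (1 + t.card) * (2 / ε) * ‖z - w‖ * F z := by ring

end BidualOfBoundedSequences

section BidualOfBoundedSequences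

open scoped BoundedContinuousFunction

variable {𝕜 : Type*} [RCLike 𝕜]

/-- A point `y` of the bidual ball, seen from a functional `μ`, splits into pieces of `μ` on each of
which `y` is a convex combination of two points that are unimodular there. -/
theorem exists_pieces_and_modifications (μ : StrongDual 𝕜 (ℕ →ᵇ 𝕜)) (hμ : ‖μ‖ = 1)
    (s : ℕ →ᵇ 𝕜) (hs : ∀ n, ‖s n‖ = 1)
    (y : StrongDual 𝕜 (StrongDual 𝕜 (ℕ →ᵇ 𝕜))) (hy : ‖y‖ ≤ 1) (ε : ℝ) (hε : 0 < ε) :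
    ∃ (t : Finset 𝕜) (m : 𝕜 → StrongDual 𝕜 (ℕ →ᵇ 𝕜)) (ρ : ℝ), 0 < ρ ∧ t.card * ρ ≤ ε ∧
      ∑ c ∈ t, m c = μ ∧ ∑ c ∈ t, ‖m c‖ ≤ 1 ∧
      ∀ c ∈ t, ∃ (u v : 𝕜) (a b : ℝ) (yu yv : StrongDual 𝕜 (StrongDual 𝕜 (ℕ →ᵇ 𝕜))),
        ‖u‖ = 1 ∧ ‖v‖ = 1 ∧ 0 ≤ a ∧ 0 ≤ b ∧ a + b = 1 ∧ ‖yu‖ ≤ 1 ∧ ‖yv‖ ≤ 1 ∧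
        ‖yu (m c) - u * m c s‖ ≤ ρ ∧ ‖yv (m c) - v * m c s‖ ≤ ρ ∧
        ‖y - ((a : 𝕜) • yu + (b : 𝕜) • yv)‖ ≤ ε := by
  classical
  obtain ⟨t, φ, K, hK, ht, hφ0, hφs, hφ1, hφl⟩ := exists_partition_unitDisc 𝕜 ε hε
  set ρ := ε / (t.card + 1) with hρ
  have hρ0 : 0 < ρ := by positivity
  obtain ⟨b, hb, hby, hbp⟩ := exists_concentrated_net μ hμ.le y hy (ρ / (2 * K)) (by positivity)
  have hbn : ∀ i n, ‖star (s n) * b i n‖ ≤ 1 := fun i n => by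
    rw [norm_mul, norm_star, hs, one_mul]
    exact ((b i).norm_coe_le_norm n).trans (hb i)
  have hφ1' : ∀ c ∈ t, ∀ z, ‖z‖ ≤ 1 → φ c z ≤ 1 := fun c hc z hz => by
    rw [← hφ1 z hz]
    exact Finset.single_le_sum (f := fun c => φ c z) (fun c _ => hφ0 c z) hc
  have hΦb : ∀ c i n, ‖(((if c ∈ t then φ c (star (s n) * b i n) else 0 : ℝ)) : 𝕜)‖ ≤ 1 := by
    intro c i n
    rw [RCLike.norm_ofReal]
    split_ifs with hc
    · rw [abs_of_nonneg (hφ0 _ _)]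
      exact hφ1' c hc _ (hbn i n)
    · simp
  let Φ : 𝕜 → Finset (StrongDual 𝕜 (ℕ →ᵇ 𝕜)) × ℕ → ℕ →ᵇ 𝕜 := fun c i =>
    boundedSeq (fun n => (((if c ∈ t then φ c (star (s n) * b i n) else 0 : ℝ)) : 𝕜)) 1 (hΦb c i)
  have hΦ : ∀ c ∈ t, ∀ i n, Φ c i n = ((φ c (star (s n) * b i n) : ℝ) : 𝕜) := fun c hc i n => by
    simp only [Φ, boundedSeq_apply, if_pos hc]
  let i₀ : Finset (StrongDual 𝕜 (ℕ →ᵇ 𝕜)) × ℕ := (∅, 0)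
  let m : 𝕜 → StrongDual 𝕜 (ℕ →ᵇ 𝕜) := fun c => mulDual μ (Φ c i₀)
  have hΦ1 : ∑ c ∈ t, Φ c i₀ = 1 := by
    ext n
    rw [BoundedContinuousFunction.coe_sum, Finset.sum_apply, Finset.sum_congr rfl
      fun c hc => hΦ c hc i₀ n, ← RCLike.ofReal_sum, hφ1 _ (hbn i₀ n)]
    simp
  refine ⟨t, m, ρ, hρ0, ?_, ?_, ?_, ?_⟩
  · rw [hρ, mul_div_assoc', div_le_iff₀ (by positivity)]
    nlinarith
  · rw [← mulDual_sum, hΦ1, mulDual_one]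
  · rw [← hμ, ← mulDual_one μ]
    simp only [m, mulDual_one]
    conv_rhs => rw [← mulDual_one μ]
    refine sum_norm_mulDual_le t μ _ 1 fun n => ?_
    change _ ≤ ‖(1 : 𝕜)‖
    rw [norm_one, ← hφ1 _ (hbn i₀ n)]
    refine le_of_eq (Finset.sum_congr rfl fun c hc => ?_)
    rw [hΦ c hc, RCLike.norm_ofReal, abs_of_nonneg (hφ0 _ _)]
  intro c hc
  let U : Ultrafilter (Finset (StrongDual 𝕜 (ℕ →ᵇ 𝕜)) × ℕ) := Ultrafilter.of Filter.atTop
  have hU : (U : Filter (Finset (StrongDual 𝕜 (ℕ →ᵇ 𝕜)) × ℕ)) ≤ Filter.atTop := Ultrafilter.of_le _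
  have hmodb : ∀ u : 𝕜, ‖u‖ ≤ 1 → ∀ i n,
      ‖if ‖star (s n) * b i n - c‖ < ε then u * s n else b i n‖ ≤ 1 := by
    intro u hu i n
    split_ifs
    · rw [norm_mul, hs, mul_one]; exact hu
    · exact ((b i).norm_coe_le_norm n).trans (hb i)
  have hmod : ∀ u : 𝕜, ‖u‖ = 1 → ∃ (B : Finset (StrongDual 𝕜 (ℕ →ᵇ 𝕜)) × ℕ → ℕ →ᵇ 𝕜)
      (yu : StrongDual 𝕜 (StrongDual 𝕜 (ℕ →ᵇ 𝕜))),
      (∀ i n, B i n = if ‖star (s n) * b i n - c‖ < ε then u * s n else b i n) ∧ ‖yu‖ ≤ 1 ∧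
      (∀ ν, Filter.Tendsto (fun i => ν (B i)) U (nhds (yu ν))) ∧
      ‖yu (m c) - u * m c s‖ ≤ ρ := by
    intro u hu
    let B : Finset (StrongDual 𝕜 (ℕ →ᵇ 𝕜)) × ℕ → ℕ →ᵇ 𝕜 := fun i => boundedSeq _ 1 (hmodb u hu.le i)
    have hB1 : ∀ i, ‖B i‖ ≤ 1 := fun i => norm_boundedSeq_le _ _ _
    have hB : ∀ i n, B i n = if ‖star (s n) * b i n - c‖ < ε then u * s n else b i n :=
      fun i n => rfl
    obtain ⟨yu, hyu, hlim⟩ := exists_tendsto_dual_of_ultrafilter U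
      (fun i => NormedSpace.inclusionInDoubleDual 𝕜 (ℕ →ᵇ 𝕜) (B i)) 1 fun i =>
        (NormedSpace.double_dual_bound 𝕜 _ (B i)).trans (hB1 i)
    have hlim' : ∀ ν, Filter.Tendsto (fun i => ν (B i)) U (nhds (yu ν)) := hlim
    refine ⟨B, yu, hB, hyu, hlim', ?_⟩
    refine le_of_tendsto ((hlim' (m c)).sub_const (u * m c s)).norm
      (Filter.Eventually.of_forall fun i => ?_)
    have hzero : Φ c i * (B i - u • s) = 0 := by
      ext n
      change Φ c i n * (B i n - u * s n) = 0
      rw [hΦ c hc, hB]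
      split_ifs with h
      · rw [sub_self, mul_zero]
      · have : φ c (star (s n) * b i n) = 0 := by
          by_contra hne
          exact h (hφs c _ hne)
        rw [this, RCLike.ofReal_zero, zero_mul]
    have h1 : m c (B i) - u * m c s = mulDual μ (Φ c i₀ - Φ c i) (B i - u • s) := by
      have h0 : m c (B i) - u * m c s = m c (B i - u • s) := by
        rw [map_sub, map_smul, smul_eq_mul]
      have h5 : (Φ c i₀ - Φ c i) * (B i - u • s) = Φ c i₀ * (B i - u • s) := by
        rw [sub_mul, hzero, sub_zero]
      rw [h0]
      exact congrArg μ h5.symm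
    have h2 : ‖mulDual μ (Φ c i₀ - Φ c i)‖ ≤ ‖mulDual μ ((K : 𝕜) • (b i₀ - b i))‖ := by
      refine norm_mulDual_mono _ _ _ fun n => ?_
      change ‖Φ c i₀ n - Φ c i n‖ ≤ ‖(K : 𝕜) • (b i₀ n - b i n)‖
      rw [hΦ c hc, hΦ c hc, ← RCLike.ofReal_sub, RCLike.norm_ofReal, norm_smul, RCLike.norm_ofReal,
        abs_of_pos hK]
      refine (hφl c hc _ _ (hbn i₀ n) (hbn i n)).trans (le_of_eq ?_)
      rw [← mul_sub, norm_mul, norm_star, hs, one_mul]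
    have h3 : ‖mulDual μ ((K : 𝕜) • (b i₀ - b i))‖ ≤ K * (ρ / (2 * K)) := by
      rw [mulDual_smul, norm_smul, RCLike.norm_ofReal, abs_of_pos hK]
      gcongr
      exact hbp i₀ i
    have h4 : ‖B i - u • s‖ ≤ 2 := by
      refine (norm_sub_le _ _).trans ?_
      have hs1 : ‖s‖ ≤ 1 := (BoundedContinuousFunction.norm_le zero_le_one).2 fun n => (hs n).le
      rw [norm_smul, hu, one_mul]
      linarith [hB1 i]
    rw [h1]
    calc ‖mulDual μ (Φ c i₀ - Φ c i) (B i - u • s)‖ ≤ (K * (ρ / (2 * K))) * 2 :=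
          (ContinuousLinearMap.le_opNorm _ _).trans
            (mul_le_mul (h2.trans h3) h4 (norm_nonneg _) (by positivity))
      _ = ρ := by field_simp
  obtain ⟨u, v, a, a', hu, hv, ha, ha', haa, hc'⟩ :=
    exists_convex_combination_unit (𝕜 := 𝕜) c (ht c hc)
  obtain ⟨Bu, yu, hBu, hyu, hlimu, hmu⟩ := hmod u hu
  obtain ⟨Bv, yv, hBv, hyv, hlimv, hmv⟩ := hmod v hv
  refine ⟨u, v, a, a', yu, yv, hu, hv, ha, ha', haa, hyu, hyv, hmu, hmv, ?_⟩
  refine ContinuousLinearMap.opNorm_le_bound _ hε.le fun ν => ?_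
  have hlim : Filter.Tendsto (fun i => ν (b i - ((a : 𝕜) • Bu i + (a' : 𝕜) • Bv i))) U
      (nhds ((y - ((a : 𝕜) • yu + (a' : 𝕜) • yv)) ν)) := by
    have := ((hby ν).mono_left hU).sub (((hlimu ν).const_mul (a : 𝕜)).add
      ((hlimv ν).const_mul (a' : 𝕜)))
    have h0 : ∀ i, ν (b i - ((a : 𝕜) • Bu i + (a' : 𝕜) • Bv i)) =
        ν (b i) - ((a : 𝕜) * ν (Bu i) + (a' : 𝕜) * ν (Bv i)) := fun i => by
      rw [map_sub, map_add, map_smul, map_smul, smul_eq_mul, smul_eq_mul]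
    simp only [h0]
    exact this
  refine le_of_tendsto hlim.norm (Filter.Eventually.of_forall fun i => ?_)
  refine (ν.le_opNorm _).trans ?_
  rw [mul_comm]
  gcongr
  refine (BoundedContinuousFunction.norm_le hε.le).2 fun n => ?_
  change ‖b i n - ((a : 𝕜) * Bu i n + (a' : 𝕜) * Bv i n)‖ ≤ ε
  have haa' : (a : 𝕜) + (a' : 𝕜) = 1 := by exact_mod_cast haa
  rw [hBu, hBv]
  split_ifs with h
  · have hss : s n * star (s n) = 1 := by
      rw [RCLike.star_def, RCLike.mul_conj, hs]; simp
    have h1 : b i n - ((a : 𝕜) * (u * s n) + (a' : 𝕜) * (v * s n)) =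
        s n * (star (s n) * b i n - c) := by
      rw [hc', smul_eq_mul, smul_eq_mul]
      linear_combination (-(b i n)) * hss
    rw [h1, norm_mul, hs, one_mul]
    exact h.le
  · rw [← add_mul, haa', one_mul, sub_self, norm_zero]
    exact hε.le

instance nontrivial_dual_boundedSeq : Nontrivial (StrongDual 𝕜 (ℕ →ᵇ 𝕜)) := by
  have h : (1 : ℕ →ᵇ 𝕜) ≠ 0 := fun h => one_ne_zero (α := 𝕜) (DFunLike.congr_fun h 0)
  obtain ⟨g, hg, -⟩ := exists_dual_vector 𝕜 (1 : ℕ →ᵇ 𝕜) (norm_ne_zero_iff.2 h)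
  exact ⟨g, 0, by rw [← norm_ne_zero_iff, hg]; exact one_ne_zero⟩

/-- A dual space has the alternative Daugavet property if every point `y` of its ball is, on pieces
of any given predual vector, a convex combination of points that are unimodular there. -/
theorem alternativeDaugavet_dual_of_pieces {M : Type*} [NormedAddCommGroup M] [NormedSpace 𝕜 M]
    [Nontrivial M]
    (h : ∀ μ : M, ‖μ‖ = 1 → ∀ y : StrongDual 𝕜 M, ‖y‖ ≤ 1 → ∀ ε : ℝ, 0 < ε →
      ∃ (t : Finset 𝕜) (m : 𝕜 → M) (ρ : ℝ) (g : StrongDual 𝕜 M), 0 < ρ ∧ t.card * ρ ≤ ε ∧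
      1 - ε ≤ RCLike.re (g μ) ∧ ∑ c ∈ t, m c = μ ∧ ∑ c ∈ t, ‖m c‖ ≤ 1 ∧
      ∀ c ∈ t, ∃ (u v : 𝕜) (a b : ℝ) (yu yv : StrongDual 𝕜 M),
        ‖u‖ = 1 ∧ ‖v‖ = 1 ∧ 0 ≤ a ∧ 0 ≤ b ∧ a + b = 1 ∧ ‖yu‖ ≤ 1 ∧ ‖yv‖ ≤ 1 ∧
        ‖yu (m c) - u * g (m c)‖ ≤ ρ ∧ ‖yv (m c) - v * g (m c)‖ ≤ ρ ∧
        ‖y - ((a : 𝕜) • yu + (b : 𝕜) • yv)‖ ≤ ε) :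
    AlternativeDaugavet 𝕜 (StrongDual 𝕜 M) := by
  intro T ε hε
  set τ := ‖T‖ with hτ
  have hτ0 : 0 ≤ τ := norm_nonneg T
  set δ := ε / (4 * (τ + 1)) with hδ
  have hδ0 : 0 < δ := by positivity
  have hδε : δ * (τ + 1) = ε / 4 := by rw [hδ]; field_simp
  have hδε' : δ ≤ ε / 4 := by nlinarith
  obtain ⟨y, hy, hTy⟩ := T.exists_lt_apply_of_lt_opNorm (show τ - ε / 4 < ‖T‖ by linarith)
  obtain ⟨μ, hμ, hTyμ⟩ := exists_unit_lt_apply_of_lt_opNorm (T y) hTy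
  obtain ⟨θ₀, hθ₀, hθc⟩ := exists_norm_one_mul_eq_norm (T y μ)
  set S := θ₀ • T with hS
  have hSn : ‖S‖ = τ := by rw [hS, norm_smul, hθ₀, one_mul]
  have hSyμ : S y μ = (‖T y μ‖ : 𝕜) := by
    rw [hS, smul_apply, smul_apply, smul_eq_mul, hθc]
  obtain ⟨t, m, ρ, g, hρ, htρ, hμs, hmsum, hmn, hpieces⟩ := h μ hμ y hy.le δ hδ0
  obtain ⟨c, hc, hsel⟩ : ∃ c ∈ t, (1 + τ) * ‖m c‖ - RCLike.re (S y (m c)) -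
      RCLike.re (g (m c)) + ρ ≤ (3 * (ε / 4)) * ‖m c‖ := by
    have hne : t.Nonempty := by
      rw [Finset.nonempty_iff_ne_empty]
      rintro rfl
      rw [Finset.sum_empty] at hmsum
      rw [← hmsum, norm_zero] at hμ
      exact zero_ne_one hμ
    refine Finset.exists_le_of_sum_le hne ?_
    have h1 : ∑ c ∈ t, RCLike.re (S y (m c)) = ‖T y μ‖ := by
      rw [← map_sum, ← map_sum, hmsum, hSyμ, RCLike.ofReal_re]
    have h2 : ∑ c ∈ t, RCLike.re (g (m c)) = RCLike.re (g μ) := by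
      rw [← hmsum, map_sum, map_sum]
    have h3 : 1 ≤ ∑ c ∈ t, ‖m c‖ := by
      rw [← hμ, ← hmsum]
      exact norm_sum_le _ _
    rw [Finset.sum_add_distrib, Finset.sum_sub_distrib, Finset.sum_sub_distrib, h1, h2,
      ← Finset.mul_sum, ← Finset.mul_sum, Finset.sum_const, nsmul_eq_mul]
    nlinarith
  obtain ⟨u, v, a, b, yu, yv, hu, hv, ha, hb, hab, hyu, hyv, hmu, hmv, hyuv⟩ := hpieces c hc
  obtain ⟨w, yw, hw, hyw, hmw, hre⟩ : ∃ (w : 𝕜) (yw : StrongDual 𝕜 M),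
      ‖w‖ = 1 ∧ ‖yw‖ ≤ 1 ∧ ‖yw (m c) - w * g (m c)‖ ≤ ρ ∧
      RCLike.re (S y (m c)) - τ * δ * ‖m c‖ ≤ RCLike.re (S yw (m c)) := by
    by_contra! hcon
    have h1 := hcon u yu hu hyu hmu
    have h2 := hcon v yv hv hyv hmv
    have h3 : RCLike.re (S y (m c)) = a * RCLike.re (S yu (m c)) + b * RCLike.re (S yv (m c)) +
        RCLike.re (S (y - ((a : 𝕜) • yu + (b : 𝕜) • yv)) (m c)) := by
      simp only [map_sub, map_add, map_smul, sub_apply, add_apply, smul_apply, smul_eq_mul,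
        RCLike.re_ofReal_mul]
      ring
    have h4 : RCLike.re (S (y - ((a : 𝕜) • yu + (b : 𝕜) • yv)) (m c)) ≤ τ * δ * ‖m c‖ := by
      refine (RCLike.re_le_norm _).trans ((ContinuousLinearMap.le_opNorm _ _).trans ?_)
      gcongr
      refine (S.le_opNorm _).trans ?_
      rw [hSn]
      gcongr
    generalize RCLike.re (S (y - ((a : 𝕜) • yu + (b : 𝕜) • yv)) (m c)) = r at h3 h4
    generalize RCLike.re (S y (m c)) = x at h1 h2 h3
    generalize RCLike.re (S yu (m c)) = xu at h1 h3
    generalize RCLike.re (S yv (m c)) = xv at h2 h3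
    generalize τ * δ * ‖m c‖ = k at h1 h2 h4
    have h5 : a * (x - k) + b * (x - k) = x - k := by rw [← add_mul, hab, one_mul]
    rcases ha.eq_or_lt with h0 | h0
    · have h6 := mul_lt_mul_of_pos_left h2 (show 0 < b by linarith)
      have h7 := mul_le_mul_of_nonneg_left h1.le ha
      linarith
    · have h6 := mul_lt_mul_of_pos_left h1 h0
      have h7 := mul_le_mul_of_nonneg_left h2.le hb
      linarith
  have hm0 : 0 < ‖m c‖ := by
    rcases (norm_nonneg (m c)).eq_or_lt with h | h
    · rw [norm_eq_zero.1 h.symm] at hsel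
      simp at hsel
      linarith
    · exact h
  refine ⟨w * θ₀, by rw [norm_mul, hw, hθ₀, one_mul], ?_⟩
  have hop : ContinuousLinearMap.id 𝕜 _ + (w * θ₀) • T = ContinuousLinearMap.id 𝕜 _ + w • S := by
    rw [hS, smul_smul]
  rw [hop]
  set Q := ContinuousLinearMap.id 𝕜 (StrongDual 𝕜 M) + w • S with hQ
  have hww : star w * w = 1 := by rw [RCLike.star_def, RCLike.conj_mul, hw]; simp
  have hQ1 : star w * Q yw (m c) = g (m c) + star w * (yw (m c) - w * g (m c)) + S yw (m c) := by
    have : Q yw (m c) = yw (m c) + w * S yw (m c) := by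
      simp [hQ, add_apply, smul_apply]
    rw [this, mul_add, ← mul_assoc, hww, one_mul, mul_sub, ← mul_assoc, hww]
    ring
  have hQ2 : RCLike.re (star w * Q yw (m c)) ≤ ‖Q‖ * ‖m c‖ := by
    refine (RCLike.re_le_norm _).trans ?_
    rw [norm_mul, norm_star, hw, one_mul]
    refine (ContinuousLinearMap.le_opNorm _ _).trans ?_
    gcongr
    exact (Q.le_opNorm _).trans (mul_le_of_le_one_right (norm_nonneg _) hyw)
  have hQ3 : -ρ ≤ RCLike.re (star w * (yw (m c) - w * g (m c))) := by
    refine (abs_le.1 ((RCLike.abs_re_le_norm _).trans ?_)).1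
    rw [norm_mul, norm_star, hw, one_mul]
    exact hmw
  rw [hQ1, map_add, map_add] at hQ2
  have hτδ : τ * δ ≤ ε / 4 := by nlinarith
  have hfin : (1 + τ - ε) * ‖m c‖ ≤ ‖Q‖ * ‖m c‖ := by
    have h1 := mul_le_mul_of_nonneg_right hτδ hm0.le
    generalize RCLike.re (star w * (yw (m c) - w * g (m c))) = r at hQ2 hQ3
    generalize RCLike.re (S yw (m c)) = x at hQ2 hre
    generalize RCLike.re (S y (m c)) = z at hre hsel
    generalize RCLike.re (g (m c)) = k at hQ2 hsel
    generalize ‖Q‖ * ‖m c‖ = q at hQ2 ⊢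
    linarith
  exact le_of_mul_le_mul_right hfin hm0

theorem alternativeDaugavet_bidual_boundedSeq (𝕜 : Type*) [RCLike 𝕜] :
    AlternativeDaugavet 𝕜 (StrongDual 𝕜 (StrongDual 𝕜 (ℕ →ᵇ 𝕜))) := by
  refine alternativeDaugavet_dual_of_pieces fun μ hμ y hy ε hε => ?_
  obtain ⟨s, hs, hμs⟩ := exists_unimodular_seq μ ε hε
  obtain ⟨t, m, ρ, hρ, htρ, hmsum, hmn, hpieces⟩ :=
    exists_pieces_and_modifications μ hμ s hs y hy ε hε
  exact ⟨t, m, ρ, NormedSpace.inclusionInDoubleDual 𝕜 (ℕ →ᵇ 𝕜) s, hρ, htρ, hμ ▸ hμs, hmsum, hmn,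
    hpieces⟩

end BidualOfBoundedSequences

section SequenceSpaces

open scoped BoundedContinuousFunction

variable {𝕜 : Type*} [RCLike 𝕜]

theorem alternativeDaugavet_dual_boundedSeq (𝕜 : Type*) [RCLike 𝕜] :
    AlternativeDaugavet 𝕜 (StrongDual 𝕜 (ℕ →ᵇ 𝕜)) :=
  (alternativeDaugavet_bidual_boundedSeq 𝕜).of_dual

theorem alternativeDaugavet_tridual_seqL1 (𝕜 : Type*) [RCLike 𝕜] :
    AlternativeDaugavet 𝕜 (StrongDual 𝕜 (StrongDual 𝕜 (StrongDual 𝕜 (SeqL1 𝕜)))) :=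
  (alternativeDaugavet_bidual_boundedSeq 𝕜).congr (dualIsometry (dualIsometry (dualSeqL1 𝕜)))

theorem alternativeDaugavet_tridual_seqC0 (𝕜 : Type*) [RCLike 𝕜] :
    AlternativeDaugavet 𝕜 (StrongDual 𝕜 (StrongDual 𝕜 (StrongDual 𝕜 (SeqC0 𝕜)))) :=
  (alternativeDaugavet_dual_boundedSeq 𝕜).congr
    (dualIsometry ((dualSeqL1 𝕜).trans (dualIsometry (dualSeqC0 𝕜).symm)))

/-- The `n`-th coordinate of an operator with values in `ℓ∞`. -/
noncomputable def coordFunctional (𝕜 : Type*) [RCLike 𝕜] (E : Type*) [NormedAddCommGroup E]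
    [NormedSpace 𝕜 E] (n : ℕ) : (E →L[𝕜] SeqLInfty 𝕜) →L[𝕜] StrongDual 𝕜 E :=
  ContinuousLinearMap.compL 𝕜 E (SeqLInfty 𝕜) 𝕜 (lp.evalCLM 𝕜 (fun _ : ℕ => 𝕜) ∞ n)

/-- A functional regarded as an operator into the `n`-th coordinate of `ℓ∞`. -/
noncomputable def coordEmbedding (𝕜 : Type*) [RCLike 𝕜] (E : Type*) [NormedAddCommGroup E]
    [NormedSpace 𝕜 E] (n : ℕ) : StrongDual 𝕜 E →L[𝕜] (E →L[𝕜] SeqLInfty 𝕜) :=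
  (ContinuousLinearMap.smulRightL 𝕜 E (SeqLInfty 𝕜)).flip
    (lp.single (E := fun _ : ℕ => 𝕜) ∞ n 1)

section

variable {E : Type*} [NormedAddCommGroup E] [NormedSpace 𝕜 E]

theorem coordFunctional_apply (n : ℕ) (T : E →L[𝕜] SeqLInfty 𝕜) (x : E) :
    coordFunctional 𝕜 E n T x = T x n := rfl

theorem coordEmbedding_apply (n : ℕ) (f : StrongDual 𝕜 E) (x : E) (k : ℕ) :
    coordEmbedding 𝕜 E n f x k = if k = n then f x else 0 := by
  change f x * lp.single (E := fun _ : ℕ => 𝕜) ∞ n 1 k = _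
  split_ifs with h
  · subst h
    rw [lp.single_apply_self (E := fun _ : ℕ => 𝕜) ∞ k 1, mul_one]
  · rw [lp.single_apply_ne (E := fun _ : ℕ => 𝕜) ∞ n 1 h, mul_zero]

theorem norm_apply_coord_le (T : E →L[𝕜] SeqLInfty 𝕜) (x : E) (k : ℕ) :
    ‖T x k‖ ≤ ‖T‖ * ‖x‖ :=
  (lp.norm_apply_le_norm ENNReal.top_ne_zero (T x) k).trans (T.le_opNorm x)

theorem opNorm_seqLInfty_le (T : E →L[𝕜] SeqLInfty 𝕜) {C : ℝ} (hC : 0 ≤ C)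
    (h : ∀ x k, ‖T x k‖ ≤ C * ‖x‖) : ‖T‖ ≤ C :=
  T.opNorm_le_bound hC fun x =>
    lp.norm_le_of_forall_le (mul_nonneg hC (norm_nonneg x)) (h x)

theorem AlternativeDaugavet.operators_seqLInfty (hE : AlternativeDaugavet 𝕜 (StrongDual 𝕜 E)) :
    AlternativeDaugavet 𝕜 (E →L[𝕜] SeqLInfty 𝕜) := by
  refine hE.of_mSummands (coordFunctional 𝕜 E) (coordEmbedding 𝕜 E) ?_ ?_ ?_ ?_
  · intro n f
    ext x
    rw [coordFunctional_apply, coordEmbedding_apply, if_pos rfl]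
  · intro n T
    refine ContinuousLinearMap.opNorm_le_bound _ (norm_nonneg _) fun x => ?_
    rw [coordFunctional_apply]
    exact norm_apply_coord_le T x n
  · intro n f T hf hT
    refine opNorm_seqLInfty_le _ zero_le_one fun x k => ?_
    rw [one_mul]
    have h1 : (coordEmbedding 𝕜 E n f + (T - coordEmbedding 𝕜 E n (coordFunctional 𝕜 E n T))) x k =
        (if k = n then f x else 0) + (T x k - (if k = n then T x n else 0)) := by
      rw [← coordFunctional_apply n T x, ← coordEmbedding_apply, ← coordEmbedding_apply]
      rfl
    rw [h1]
    split_ifs with h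
    · subst h
      rw [sub_self, add_zero]
      exact (f.le_opNorm x).trans (mul_le_of_le_one_left (norm_nonneg _) hf)
    · rw [zero_add, sub_zero]
      exact (norm_apply_coord_le T x k).trans (mul_le_of_le_one_left (norm_nonneg _) hT)
  · intro T C hC h
    refine opNorm_seqLInfty_le T hC fun x k => ?_
    rw [← coordFunctional_apply]
    exact (ContinuousLinearMap.le_opNorm _ x).trans
      (mul_le_mul_of_nonneg_right (h k) (norm_nonneg x))

end

theorem alternativeDaugavet_dual_seqLInfty (𝕜 : Type*) [RCLike 𝕜] :
    AlternativeDaugavet 𝕜 (StrongDual 𝕜 (SeqLInfty 𝕜)) :=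
  (alternativeDaugavet_dual_boundedSeq 𝕜).congr (dualIsometry (lpBCFₗᵢ 𝕜 𝕜).symm)

theorem numericalIndex_operators_seqLInfty (𝕜 : Type*) [RCLike 𝕜] :
    numericalIndex 𝕜 (SeqLInfty 𝕜 →L[𝕜] SeqLInfty 𝕜) = 1 :=
  (alternativeDaugavet_dual_seqLInfty 𝕜).operators_seqLInfty.numericalIndex_eq_one

set_option maxHeartbeats 1000000 in
theorem alternativeDaugavet_bidual_compactOps_seqC0 (𝕜 : Type*) [RCLike 𝕜] :
    AlternativeDaugavet 𝕜
      (StrongDual 𝕜 (StrongDual 𝕜 (CompactOps 𝕜 (SeqC0 𝕜) (SeqC0 𝕜)))) :=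
  alternativeDaugavet_bidual_compactOps (alternativeDaugavet_tridual_seqC0 𝕜)
    (isIsometricPredualL1_seqC0 𝕜)

set_option maxHeartbeats 1000000 in
theorem alternativeDaugavet_dual_compactOps_seqC0 (𝕜 : Type*) [RCLike 𝕜] :
    AlternativeDaugavet 𝕜 (StrongDual 𝕜 (CompactOps 𝕜 (SeqC0 𝕜) (SeqC0 𝕜))) :=
  (alternativeDaugavet_bidual_compactOps_seqC0 𝕜).of_dual

set_option maxHeartbeats 1000000 in
theorem numericalIndex_bidual_compactOps_seqC0 (𝕜 : Type*) [RCLike 𝕜] :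
    numericalIndex 𝕜 (StrongDual 𝕜 (StrongDual 𝕜 (CompactOps 𝕜 (SeqC0 𝕜) (SeqC0 𝕜)))) = 1 :=
  (alternativeDaugavet_bidual_compactOps_seqC0 𝕜).numericalIndex_eq_one

set_option maxHeartbeats 1000000 in
theorem numericalIndex_dual_compactOps_seqC0 (𝕜 : Type*) [RCLike 𝕜] :
    numericalIndex 𝕜 (StrongDual 𝕜 (CompactOps 𝕜 (SeqC0 𝕜) (SeqC0 𝕜))) = 1 :=
  (alternativeDaugavet_dual_compactOps_seqC0 𝕜).numericalIndex_eq_one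

set_option maxHeartbeats 1000000 in
theorem numericalIndex_compactOps_seqC0 (𝕜 : Type*) [RCLike 𝕜] :
    numericalIndex 𝕜 (CompactOps 𝕜 (SeqC0 𝕜) (SeqC0 𝕜)) = 1 :=
  (alternativeDaugavet_dual_compactOps_seqC0 𝕜).of_dual.numericalIndex_eq_one

set_option maxHeartbeats 1000000 in
theorem alternativeDaugavet_bidual_compactOps_seqL1_seqC0 (𝕜 : Type*) [RCLike 𝕜] :
    AlternativeDaugavet 𝕜
      (StrongDual 𝕜 (StrongDual 𝕜 (CompactOps 𝕜 (SeqL1 𝕜) (SeqC0 𝕜)))) :=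
  alternativeDaugavet_bidual_compactOps (alternativeDaugavet_tridual_seqL1 𝕜)
    (isIsometricPredualL1_seqC0 𝕜)

set_option maxHeartbeats 1000000 in
theorem numericalIndex_bidual_compactOps_seqL1_seqC0 (𝕜 : Type*) [RCLike 𝕜] :
    numericalIndex 𝕜 (StrongDual 𝕜 (StrongDual 𝕜 (CompactOps 𝕜 (SeqL1 𝕜) (SeqC0 𝕜)))) = 1 :=
  (alternativeDaugavet_bidual_compactOps_seqL1_seqC0 𝕜).numericalIndex_eq_one

end SequenceSpaces

theorem mainTheorem10 (𝕜 : Type*) [RCLike 𝕜] :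
    (∀ (X : Type*) [NormedAddCommGroup X] [NormedSpace 𝕜 X] [CompleteSpace X]
        (Z : Type*) [NormedAddCommGroup Z] [NormedSpace 𝕜 Z] [CompleteSpace Z],
        numericalIndex 𝕜 (StrongDual 𝕜 (StrongDual 𝕜 (StrongDual 𝕜 X))) = 1 →
        IsIsometricPredualL1 𝕜 Z →
          numericalIndex 𝕜 (StrongDual 𝕜 (StrongDual 𝕜 (CompactOps 𝕜 X Z))) = 1 ∧
          numericalIndex 𝕜 (StrongDual 𝕜 (CompactOps 𝕜 X Z)) = 1 ∧
          numericalIndex 𝕜 (CompactOps 𝕜 X Z) = 1) ∧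
    numericalIndex 𝕜 (CompactOps 𝕜 (SeqC0 𝕜) (SeqC0 𝕜)) = 1 ∧
    numericalIndex 𝕜 (StrongDual 𝕜 (CompactOps 𝕜 (SeqC0 𝕜) (SeqC0 𝕜))) = 1 ∧
    numericalIndex 𝕜 (StrongDual 𝕜 (StrongDual 𝕜 (CompactOps 𝕜 (SeqC0 𝕜) (SeqC0 𝕜)))) = 1 ∧
    numericalIndex 𝕜 (SeqLInfty 𝕜 →L[𝕜] SeqLInfty 𝕜) = 1 ∧
    numericalIndex 𝕜 (StrongDual 𝕜 (StrongDual 𝕜 (CompactOps 𝕜 (SeqL1 𝕜) (SeqC0 𝕜)))) = 1 := by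
  refine ⟨?_, numericalIndex_compactOps_seqC0 𝕜, numericalIndex_dual_compactOps_seqC0 𝕜,
    numericalIndex_bidual_compactOps_seqC0 𝕜, numericalIndex_operators_seqLInfty 𝕜,
    numericalIndex_bidual_compactOps_seqL1_seqC0 𝕜⟩
  intro X _ _ _ Z _ _ _ hX hZ
  have h := alternativeDaugavet_bidual_compactOps (numericalIndex_eq_one_iff.1 hX) hZ
  exact ⟨h.numericalIndex_eq_one, h.of_dual.numericalIndex_eq_one,
    h.of_dual.of_dual.numericalIndex_eq_one⟩
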